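/- Let $p,q\ge 2$ be integers, $d=\lfloor p/q+q/p\rfloor$, and let $n,h$ be integers with $n/2\le h\le n$ and $h\ge d+2$. Let $\mathfrak X=(X_1,\dots,X_n)$ be i.i.d. random $p\times q$ real matrices whose distribution is absolutely continuous with respect to Lebesgue measure. Put $m=\min(n-h+1,\;h-(d+1))$. Estimators. For a sample $\mathfrak Y=(Y_1,\dots,Y_n)$ of $p\times q$ matrices and weights $v_1,\dots,v_n\ge 0$, a weighted maximum likelihood estimate is a triple $(M,\Sigma^{\rm row},\Sigma^{\rm col})$ with $\Sigma^{\rm row}\in\mathbb R^{p\times p}$, $\Sigma^{\rm col}\in\mathbb R^{q\times q}$ symmetric positive definite such that, with $s=\sum_i v_i$, $$M=\frac1s\sum_i v_iY_i,\quad \Sigma^{\rm row}=\frac1{qs}\sum_i v_i (Y_i-M)(\Sigma^{\rm col})^{-1}(Y_i-M)',\quad \Sigma^{\rm col}=\frac1{ps}\sum_i v_i (Y_i-M)'(\Sigma^{\rm row})^{-1}(Y_i-M).$$ The raw MMCD estimates $(\hat M,\hat\Sigma^{\rm row},\hat\Sigma^{\rm col})$ of $\mathfrak Y$ are the estimates obtained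 with $v_i=1$ for $i\in H$ and $v_i=0$ otherwise, where $H\subset\{1,\dots,n\}$, $|H|=h$, is chosen such that $p\ln\det\Sigma^{\rm col}+q\ln\det\Sigma^{\rm row}$ is minimal among all subsets of size $h$ (any minimizer is allowed). The matrix Mahalanobis distance is $\mathrm{mmd}(Y_i)=\sqrt{\mathrm{tr}\big((\hat\Sigma^{\rm col})^{-1}(Y_i-\hat M)'(\hat\Sigma^{\rm row})^{-1}(Y_i-\hat M)\big)}$, and the reweighted MMCD estimates $(\tilde M,\tilde\Sigma^{\rm row},\tilde\Sigma^{\rm col})$ are the weighted maximum likelihood estimates with $v_i=w(\mathrm{mmd}(Y_i))$. Breakdown points. The location breakdown point $\varepsilon^*(\tilde M,\mathfrak X)$ is the least $k/n$, $1\le k\le n$, such that $\|\tilde M_{\mathfrak X}-\tilde M_{\mathfrak Y}\|$ is unbounded when $\mathfrak Y$ runs over all samples obtained from $\mathfrak X$ by replacing $k$ observations by arbitrary matrices. The covariance breakdown point $\varepsilon^*(\tilde\Sigma^{\rm row},\tilde\Sigma^{\rm col},\mathfrak X)$ is defined in the same way with $\max_{i,j}\big|\log(\lambda_i(\tilde\Sigma^{\rm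 row}_{\mathfrak Y})\lambda_j(\tilde\Sigma^{\rm col}_{\mathfrak Y}))-\log(\lambda_i(\tilde\Sigma^{\rm row}_{\mathfrak X})\lambda_j(\tilde\Sigma^{\rm col}_{\mathfrak X}))\big|$ in place of the norm, where $\lambda_1\ge\lambda_2\ge\cdots$ denote the ordered eigenvalues. Non-existence of an estimate counts as an infinite deviation. Theorem. Almost surely, the following holds for every non-increasing bounded function $w:[0,\infty)\to[0,\infty)$ and every $c_1>0$ with $w(t)=0$ for all $t>c_1$. Suppose that at every sample $\mathfrak Y$ obtained from $\mathfrak X$ by replacing at most $m-1$ observations, and for every raw MMCD estimate of $\mathfrak Y$, at least $\lfloor (n+d+2)/2\rfloor$ of the weights $w(\mathrm{mmd}(Y_i))$ are positive. Then $$\varepsilon^*(\tilde M,\mathfrak X)\ge\frac mn\qquad\text{and}\qquad \varepsilon^*(\tilde\Sigma^{\rm row},\tilde\Sigma^{\rm col},\mathfrak X)\ge\frac mn .$$ -/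

import Mathlib

open MeasureTheory ProbabilityTheory Matrix
open scoped ENNReal

namespace MMCD

/-- The Borel sigma-algebra on real `p × q` matrices (product over the entries). -/
instance matrixMeasurableSpace (p q : ℕ) : MeasurableSpace (Matrix (Fin p) (Fin q) ℝ) :=
  inferInstanceAs (MeasurableSpace (Fin p → Fin q → ℝ))

/-- Lebesgue measure on real `p × q` matrices, identified with `ℝ^(p*q)` through the entries. -/
noncomputable def lebesgue (p q : ℕ) : Measure (Matrix (Fin p) (Fin q) ℝ) :=
  (volume : Measure (Fin p → Fin q → ℝ))

/-- A sample of `n` real `p × q` matrices. -/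
abbrev Sample (n p q : ℕ) : Type := Fin n → Matrix (Fin p) (Fin q) ℝ

/-- The integer `d = ⌊p / q + q / p⌋`. -/
def dimRatio (p q : ℕ) : ℕ := ⌊(p : ℚ) / q + (q : ℚ) / p⌋₊

/-- A parameter `(M, Σ^row, Σ^col)`: a location matrix and symmetric positive definite rowwise and
columnwise covariance matrices. -/
structure Params (p q : ℕ) where
  /-- location -/
  loc : Matrix (Fin p) (Fin q) ℝ
  /-- rowwise covariance -/
  row : Matrix (Fin p) (Fin p) ℝ
  /-- columnwise covariance -/
  col : Matrix (Fin q) (Fin q) ℝ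
  row_posDef : row.PosDef
  col_posDef : col.PosDef

/-- The matrix Mahalanobis distance
`mmd(A) = √ tr((Σ^col)⁻¹ (A - M)' (Σ^row)⁻¹ (A - M))`. -/
noncomputable def mmd {p q : ℕ} (A : Matrix (Fin p) (Fin q) ℝ) (θ : Params p q) : ℝ :=
  √ (trace (θ.col⁻¹ * (A - θ.loc)ᵀ * θ.row⁻¹ * (A - θ.loc)))

/-- `θ` solves the estimating equations of weighted maximum likelihood with weights `v`. The two
covariance equations are coupled and have no closed form. They determine `(Σ^row, Σ^col)` at best
up to the trivial rescaling `(κ Σ^row, κ⁻¹ Σ^col)`, `κ > 0`, which changes neither the Mahalanobis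
distances nor the products of eigenvalues of the two matrices; all rescalings are kept. -/
def IsWeightedMLE {n p q : ℕ} (X : Sample n p q) (v : Fin n → ℝ) (θ : Params p q) : Prop :=
  θ.loc = (∑ i, v i)⁻¹ • ∑ i, v i • X i ∧
  θ.row = ((q : ℝ) * ∑ i, v i)⁻¹ •
    ∑ i, v i • ((X i - θ.loc) * θ.col⁻¹ * (X i - θ.loc)ᵀ) ∧
  θ.col = ((p : ℝ) * ∑ i, v i)⁻¹ •
    ∑ i, v i • ((X i - θ.loc)ᵀ * θ.row⁻¹ * (X i - θ.loc))

/-- `θ` is a maximum likelihood estimate based on the observations with index in `H`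
(weight one on `H` and zero elsewhere). -/
def IsSubsetMLE {n p q : ℕ} (X : Sample n p q) (H : Finset (Fin n)) (θ : Params p q) : Prop :=
  IsWeightedMLE X (fun i => if i ∈ H then 1 else 0) θ

/-- The objective `p ln det Σ^col + q ln det Σ^row`. -/
noncomputable def objective {p q : ℕ} (θ : Params p q) : ℝ :=
  p * Real.log θ.col.det + q * Real.log θ.row.det

/-- The raw MMCD estimates of a sample with subset size `h`: the estimates of a subset of size `h`
whose objective is minimal among all subsets of size `h`. Several subsets may be minimal, and all
of them count. There is no raw MMCD estimate if some subset of size `h` has no estimates. -/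
def rawMMCD {n p q : ℕ} (h : ℕ) (X : Sample n p q) : Set (Params p q) :=
  {θ | (∀ H : Finset (Fin n), H.card = h → ∃ θ', IsSubsetMLE X H θ') ∧
    ∃ H : Finset (Fin n), H.card = h ∧ IsSubsetMLE X H θ ∧
      ∀ (H' : Finset (Fin n)) (θ' : Params p q), H'.card = h → IsSubsetMLE X H' θ' →
        objective θ ≤ objective θ'}

/-- `w : [0, ∞) → [0, ∞)` is non-increasing, bounded, and vanishes beyond `c₁ > 0`.
The values of `w` at negative numbers play no role. -/
structure IsWeightFunction (w : ℝ → ℝ) (c₁ : ℝ) : Prop where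
  cutoff_pos : 0 < c₁
  nonneg : ∀ t, 0 ≤ t → 0 ≤ w t
  antitone : AntitoneOn w (Set.Ici 0)
  bounded : ∃ B, ∀ t, 0 ≤ t → w t ≤ B
  vanish : ∀ t, c₁ < t → w t = 0

/-- At the sample `X`, at least `⌊(n + d + 2) / 2⌋` observations get a positive weight, when the
distances are computed from any raw MMCD estimate of `X`. -/
def HasEnoughPositiveWeights {n p q : ℕ} (h : ℕ) (w : ℝ → ℝ) (X : Sample n p q) : Prop :=
  ∀ θ ∈ rawMMCD h X,
    (n + dimRatio p q + 2) / 2 ≤ (Finset.univ.filter fun i => 0 < w (mmd (X i) θ)).card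

/-- The reweighted MMCD estimates: weighted maximum likelihood estimates, the weights being
`w` of the Mahalanobis distances with respect to a raw MMCD estimate. There is no reweighted
estimate if for some choice of the raw estimate the weighted equations have no solution. -/
def reweightedMMCD {n p q : ℕ} (h : ℕ) (w : ℝ → ℝ) (X : Sample n p q) : Set (Params p q) :=
  {η | (∀ θ ∈ rawMMCD h X, ∃ η', IsWeightedMLE X (fun i => w (mmd (X i) θ)) η') ∧
    ∃ θ ∈ rawMMCD h X, IsWeightedMLE X (fun i => w (mmd (X i) θ)) η}

/-- `Y` arises from `X` by replacing `k` observations by arbitrary matrices (an observation may be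
replaced by itself, so that at most `k` of them differ). -/
def IsCorruption {n p q : ℕ} (k : ℕ) (X Y : Sample n p q) : Prop :=
  {i | Y i ≠ X i}.ncard ≤ k

/-- The Frobenius norm. -/
noncomputable def frobenius {p q : ℕ} (A : Matrix (Fin p) (Fin q) ℝ) : ℝ :=
  √ (trace (Aᵀ * A))

/-- Distance between the location components of two parameters. -/
noncomputable def locationDeviation {p q : ℕ} (θ η : Params p q) : ℝ≥0∞ :=
  ENNReal.ofReal (frobenius (θ.loc - η.loc))

/-- `max_{i,j} |log(λ_i(Σ^row_η) λ_j(Σ^col_η)) - log(λ_i(Σ^row_θ) λ_j(Σ^col_θ))|`, with the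
eigenvalues in decreasing order. -/
noncomputable def covarianceDeviation {p q : ℕ} (θ η : Params p q) : ℝ≥0∞ :=
  ⨆ (i : Fin (Fintype.card (Fin p))) (j : Fin (Fintype.card (Fin q))),
    ENNReal.ofReal
      |Real.log (η.row_posDef.isHermitian.eigenvalues₀ i * η.col_posDef.isHermitian.eigenvalues₀ j)
        - Real.log
          (θ.row_posDef.isHermitian.eigenvalues₀ i * θ.col_posDef.isHermitian.eigenvalues₀ j)|

open Classical in
/-- The largest deviation that replacing `k` observations of `X` can cause in the estimator `T`
(given by its set of values at each sample). It is infinite if `T` has no value at `X` or at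
some corrupted sample. -/
noncomputable def maxDeviation {n p q : ℕ} (D : Params p q → Params p q → ℝ≥0∞)
    (T : Sample n p q → Set (Params p q)) (X : Sample n p q) (k : ℕ) : ℝ≥0∞ :=
  ⨆ (Y : Sample n p q) (_ : IsCorruption k X Y),
    if (T X).Nonempty ∧ (T Y).Nonempty then ⨆ θ ∈ T X, ⨆ η ∈ T Y, D θ η else ⊤

/-- The finite sample breakdown point of the estimator `T` at `X` for the deviation `D`: the least
`k / n`, `1 ≤ k ≤ n`, such that the deviation caused by replacing `k` observations is unbounded
(`∞` if there is no such `k`). -/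
noncomputable def breakdownPoint {n p q : ℕ} (D : Params p q → Params p q → ℝ≥0∞)
    (T : Sample n p q → Set (Params p q)) (X : Sample n p q) : ℝ≥0∞ :=
  ⨅ (k : ℕ) (_ : 1 ≤ k ∧ k ≤ n ∧ maxDeviation D T X k = ⊤), (k : ℝ≥0∞) / n

/-- Breakdown point of the location component of an estimator. -/
noncomputable def locationBreakdownPoint {n p q : ℕ}
    (T : Sample n p q → Set (Params p q)) (X : Sample n p q) : ℝ≥0∞ :=
  breakdownPoint locationDeviation T X

/-- Joint breakdown point of the covariance components of an estimator. -/
noncomputable def covarianceBreakdownPoint {n p q : ℕ}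
    (T : Sample n p q → Set (Params p q)) (X : Sample n p q) : ℝ≥0∞ :=
  breakdownPoint covarianceDeviation T X

/-- The integer `m = min(n - h + 1, h - (d + 1))`; the subtractions are exact for
`d + 2 ≤ h ≤ n`. -/
def breakdownCount (n p q h : ℕ) : ℕ := min (n - h + 1) (h - (dimRatio p q + 1))

end MMCD

/-! Write Σ^row = S diag(exp(-a)) S' and Σ^col = T diag(exp(-b)) T' with S, T orthogonal. For fixed
location the Gaussian likelihood becomes Σ c_jk exp(a_j + b_k) - (q Σ a_j + p Σ b_k), where c_jk is
the mean square of the (j,k) entry of the centred data in the rotated coordinates. It is coercive in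
the sums a_j + b_k, uniformly in the data, as soon as every block J × K with pq ≤ q|J| + p|K|
contains some c_jk ≥ ε. This is a Hall-type duality (`weighted_sum_add_spread_le`,
`exists_bound_of_isExpanding`).

Almost surely, any d+2 observations of the original sample have this property for a common ε. A
counterexample gives d+1 differences with a common vanishing block after a change of bases. The
choice of the two subspaces costs w(p-w) + v(q-v) parameters and the block imposes (d+1)wv
equations; since (d+1)pq > p² + q², the equations win and the exceptional set is null
(`volume_range_blockChart`, `dimension_count`). Compactness of the orthogonal groups provides the
uniform ε (`exists_inGeneralPosition`).

Coercivity gives existence of estimates (`exists_isWeightedMLE`); conversely, every solution of the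
estimating equations is a global minimum of the likelihood (`mle_le_likelihood`). Now replace k ≤
m-1 observations. Since k ≤ n-h, some clean subset of size h bounds the raw objective from above.
Since k ≤ h-(d+2), the optimal subset contains d+2 clean observations, which bounds spectrum and
location (`exists_rawMMCD_bound`).

The hypothesis makes many weights positive, but they might tend to zero along a sequence of
corrupted samples. This is excluded by compactness of the set of pairs of a sample and a raw
estimate, after truncation of far outliers (`exists_uniform_distance`). The two bounds on k add up
to k + d + 2 ≤ ⌊(n+d+2)/2⌋, so d+2 clean observations have weight bounded below. Observations with
positive weight are bounded because their distance is at most c₁, and the coercivity argument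
applies once more (`exists_reweightedMMCD_bound`). -/

namespace MMCD

/-! ### Diagonalization and the Mahalanobis norm in spectral coordinates -/

section Spectral

variable {p q : ℕ}

/-- The squared Mahalanobis norm `tr(B⁻¹ Z' A⁻¹ Z)`. -/
noncomputable def mahalanobisSq (Z : Matrix (Fin p) (Fin q) ℝ) (A : Matrix (Fin p) (Fin p) ℝ)
    (B : Matrix (Fin q) (Fin q) ℝ) : ℝ :=
  trace (B⁻¹ * Zᵀ * A⁻¹ * Z)

theorem spectral_decomposition {C : Matrix (Fin p) (Fin p) ℝ} (hC : C.IsHermitian) :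
    ∃ S : Matrix (Fin p) (Fin p) ℝ, Sᵀ * S = 1 ∧ C = S * diagonal hC.eigenvalues * Sᵀ := by
  refine ⟨hC.eigenvectorUnitary, ?_, ?_⟩
  · have := (Matrix.mem_unitaryGroup_iff').1 hC.eigenvectorUnitary.2
    simpa [star_eq_conjTranspose] using this
  · have := hC.spectral_theorem
    rw [Unitary.conjStarAlgAut_apply] at this
    simpa [star_eq_conjTranspose, Function.comp_def] using this

theorem diagonal_exp_mul (a : Fin p → ℝ) :
    diagonal (fun j => Real.exp (-a j)) * diagonal (fun j => Real.exp (a j)) = 1 := by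
  rw [diagonal_mul_diagonal]
  simp [← Real.exp_add]

/-- The double negation fits the pattern exp(-a j) with a = -log(eigenvalue). With this sign the
Mahalanobis norm carries the factors exp(a j + b k). -/
theorem posDef_spectral {A : Matrix (Fin p) (Fin p) ℝ} (hA : A.PosDef) :
    ∃ S : Matrix (Fin p) (Fin p) ℝ, Sᵀ * S = 1 ∧
      A = S * diagonal (fun j => Real.exp (-(-Real.log (hA.isHermitian.eigenvalues j)))) * Sᵀ := by
  obtain ⟨S, hS, h⟩ := spectral_decomposition hA.isHermitian
  refine ⟨S, hS, ?_⟩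
  simp only [neg_neg, Real.exp_log (hA.eigenvalues_pos _)]
  exact h

theorem posDef_conj_diagonal {S : Matrix (Fin p) (Fin p) ℝ} (hS : IsUnit S) {d : Fin p → ℝ}
    (hd : ∀ j, 0 < d j) : (S * diagonal d * Sᵀ).PosDef := by
  have h1 : (diagonal d).PosDef := PosDef.diagonal hd
  have := h1.mul_mul_conjTranspose_same (B := S)
    (by exact Matrix.vecMul_injective_of_isUnit hS)
  simpa using this

theorem isUnit_of_orthogonal {S : Matrix (Fin p) (Fin p) ℝ} (hS : Sᵀ * S = 1) : IsUnit S :=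
  IsUnit.of_mul_eq_one Sᵀ (mul_eq_one_comm.1 hS)

/-- A positive definite and a symmetric matrix are simultaneously diagonal in some basis. -/
theorem simultaneous_diagonalization {A C : Matrix (Fin p) (Fin p) ℝ} (hA : A.PosDef)
    (hC : C.IsHermitian) :
    ∃ (S : Matrix (Fin p) (Fin p) ℝ) (D : Fin p → ℝ), IsUnit S ∧
      A = S * Sᵀ ∧ C = S * diagonal D * Sᵀ := by
  obtain ⟨S₀, hS₀, h⟩ := posDef_spectral hA
  set a : Fin p → ℝ := fun j => -Real.log (hA.isHermitian.eigenvalues j)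
  -- `R` is a factor with A = R R' and `Q` is its inverse; the eigenvectors of Q C Q' then
  -- diagonalize both forms.
  set R := S₀ * diagonal (fun j => Real.exp (-(a j / 2))) with hR
  have hS₀' : S₀ * S₀ᵀ = 1 := mul_eq_one_comm.1 hS₀
  have hdd := diagonal_exp_mul (fun j => a j / 2)
  set Q := diagonal (fun j => Real.exp (a j / 2)) * S₀ᵀ with hQ
  have hRQ : R * Q = 1 := by
    calc R * Q = S₀ * (diagonal (fun j => Real.exp (-(a j / 2))) *
          diagonal (fun j => Real.exp (a j / 2))) * S₀ᵀ := by
          simp only [hR, hQ, Matrix.mul_assoc]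
      _ = 1 := by rw [hdd, Matrix.mul_one, hS₀']
  have hARR : A = R * Rᵀ := by
    rw [h, hR, transpose_mul, diagonal_transpose]
    have : diagonal (fun j => Real.exp (-(a j))) = diagonal (fun j => Real.exp (-(a j / 2))) *
        diagonal (fun j => Real.exp (-(a j / 2))) := by
      rw [diagonal_mul_diagonal]
      congr 1; ext j
      rw [← Real.exp_add]; ring_nf
    change S₀ * diagonal (fun j => Real.exp (-(a j))) * S₀ᵀ = _
    rw [this]
    simp only [Matrix.mul_assoc]
  have hC' : (Q * C * Qᵀ).IsHermitian := by
    have := isHermitian_mul_mul_conjTranspose Q hC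
    simpa using this
  obtain ⟨U, D, hU, hUC⟩ : ∃ (U : Matrix (Fin p) (Fin p) ℝ) (D : Fin p → ℝ), Uᵀ * U = 1 ∧
      Q * C * Qᵀ = U * diagonal D * Uᵀ :=
    (spectral_decomposition hC').imp fun _ h => ⟨_, h⟩
  have hU' : U * Uᵀ = 1 := mul_eq_one_comm.1 hU
  refine ⟨R * U, D, ?_, ?_, ?_⟩
  · exact (IsUnit.of_mul_eq_one Q hRQ).mul (isUnit_of_orthogonal hU)
  · rw [transpose_mul, Matrix.mul_assoc, ← Matrix.mul_assoc U, hU', Matrix.one_mul, hARR]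
  · have h1 : R * (Q * C * Qᵀ) * Rᵀ = C := by
      have : Qᵀ * Rᵀ = 1 := by rw [← transpose_mul, hRQ, transpose_one]
      calc R * (Q * C * Qᵀ) * Rᵀ = (R * Q) * C * (Qᵀ * Rᵀ) := by simp only [Matrix.mul_assoc]
        _ = C := by rw [hRQ, this, Matrix.one_mul, Matrix.mul_one]
    calc C = R * (U * diagonal D * Uᵀ) * Rᵀ := by rw [← hUC, h1]
      _ = _ := by rw [transpose_mul R U]; simp only [Matrix.mul_assoc]

theorem inv_conj_diagonal {S : Matrix (Fin p) (Fin p) ℝ} (hS : IsUnit S) {d : Fin p → ℝ}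
    (hd : ∀ j, d j ≠ 0) :
    (S * diagonal d * Sᵀ)⁻¹ = S⁻¹ᵀ * diagonal (fun j => (d j)⁻¹) * S⁻¹ := by
  have hS' : IsUnit S.det := (isUnit_iff_isUnit_det _).1 hS
  apply inv_eq_right_inv
  have h1 : Sᵀ * S⁻¹ᵀ = 1 := by rw [← transpose_mul, nonsing_inv_mul _ hS', transpose_one]
  calc S * diagonal d * Sᵀ * (S⁻¹ᵀ * diagonal (fun j => (d j)⁻¹) * S⁻¹)
      = S * (diagonal d * (Sᵀ * S⁻¹ᵀ) * diagonal (fun j => (d j)⁻¹)) * S⁻¹ := by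
        simp only [Matrix.mul_assoc]
    _ = 1 := by
      rw [h1, Matrix.mul_one, diagonal_mul_diagonal]
      simp [hd, mul_nonsing_inv _ hS']

theorem trace_diagonal_mul_transpose (W : Matrix (Fin p) (Fin q) ℝ) (d : Fin p → ℝ)
    (e : Fin q → ℝ) :
    trace (diagonal e * Wᵀ * diagonal d * W) = ∑ j, ∑ k, W j k ^ 2 * d j * e k := by
  rw [Finset.sum_comm]
  simp only [trace, diag_apply]
  refine Finset.sum_congr rfl fun k _ => ?_
  rw [mul_apply]
  refine Finset.sum_congr rfl fun j _ => ?_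
  rw [mul_diagonal, diagonal_mul, transpose_apply]
  ring

theorem mahalanobisSq_conj {S : Matrix (Fin p) (Fin p) ℝ} {T : Matrix (Fin q) (Fin q) ℝ}
    (hS : IsUnit S) (hT : IsUnit T) {d : Fin p → ℝ} {e : Fin q → ℝ} (hd : ∀ j, d j ≠ 0)
    (he : ∀ k, e k ≠ 0) (W : Matrix (Fin p) (Fin q) ℝ) :
    mahalanobisSq (S * W * Tᵀ) (S * diagonal d * Sᵀ) (T * diagonal e * Tᵀ) =
      ∑ j, ∑ k, W j k ^ 2 * (d j)⁻¹ * (e k)⁻¹ := by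
  have hS' : IsUnit S.det := (isUnit_iff_isUnit_det _).1 hS
  have hT' : IsUnit T.det := (isUnit_iff_isUnit_det _).1 hT
  have h1 : Sᵀ * S⁻¹ᵀ = 1 := by rw [← transpose_mul, nonsing_inv_mul _ hS', transpose_one]
  have h2 : Tᵀ * T⁻¹ᵀ = 1 := by rw [← transpose_mul, nonsing_inv_mul _ hT', transpose_one]
  have h3 := nonsing_inv_mul _ hS'
  have h4 := nonsing_inv_mul _ hT'
  rw [← trace_diagonal_mul_transpose, mahalanobisSq, inv_conj_diagonal hS hd,
    inv_conj_diagonal hT he]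
  simp only [transpose_mul, transpose_transpose]
  set d' := diagonal (fun j => (d j)⁻¹)
  set e' := diagonal (fun j => (e j)⁻¹)
  calc trace (T⁻¹ᵀ * e' * T⁻¹ * (T * (Wᵀ * Sᵀ)) * (S⁻¹ᵀ * d' * S⁻¹) * (S * W * Tᵀ))
      = trace (T⁻¹ᵀ * (e' * (T⁻¹ * T) * Wᵀ * (Sᵀ * S⁻¹ᵀ) * d' * (S⁻¹ * S) * W * Tᵀ)) := by
        simp only [Matrix.mul_assoc]
    _ = trace (e' * Wᵀ * d' * W * (Tᵀ * T⁻¹ᵀ)) := by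
        rw [trace_mul_comm, h3, h4, h1]
        simp only [Matrix.mul_assoc, Matrix.one_mul]
    _ = _ := by rw [h2, Matrix.mul_one]

theorem orthogonal_inv {S : Matrix (Fin p) (Fin p) ℝ} (hS : Sᵀ * S = 1) : S⁻¹ = Sᵀ :=
  inv_eq_left_inv hS

theorem orthogonal_conj {S : Matrix (Fin p) (Fin p) ℝ} {T : Matrix (Fin q) (Fin q) ℝ}
    (hS : Sᵀ * S = 1) (hT : Tᵀ * T = 1) (Z : Matrix (Fin p) (Fin q) ℝ) :
    S * (Sᵀ * Z * T) * Tᵀ = Z := by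
  have hS' : S * Sᵀ = 1 := mul_eq_one_comm.1 hS
  have hT' : T * Tᵀ = 1 := mul_eq_one_comm.1 hT
  calc S * (Sᵀ * Z * T) * Tᵀ = (S * Sᵀ) * Z * (T * Tᵀ) := by simp only [Matrix.mul_assoc]
    _ = Z := by rw [hS', hT', Matrix.one_mul, Matrix.mul_one]

theorem mahalanobisSq_spectral {S : Matrix (Fin p) (Fin p) ℝ} {T : Matrix (Fin q) (Fin q) ℝ}
    (hS : Sᵀ * S = 1) (hT : Tᵀ * T = 1) (a : Fin p → ℝ) (b : Fin q → ℝ)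
    (Z : Matrix (Fin p) (Fin q) ℝ) :
    mahalanobisSq Z (S * diagonal (fun j => Real.exp (-a j)) * Sᵀ)
      (T * diagonal (fun k => Real.exp (-b k)) * Tᵀ) =
      ∑ j, ∑ k, (Sᵀ * Z * T) j k ^ 2 * Real.exp (a j + b k) := by
  have := mahalanobisSq_conj (isUnit_of_orthogonal hS) (isUnit_of_orthogonal hT)
    (d := fun j => Real.exp (-a j)) (e := fun k => Real.exp (-b k)) (fun j => (Real.exp_pos _).ne')
    (fun j => (Real.exp_pos _).ne') (Sᵀ * Z * T)
  rw [orthogonal_conj hS hT] at this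
  rw [this]
  refine Finset.sum_congr rfl fun j _ => Finset.sum_congr rfl fun k _ => ?_
  rw [← Real.exp_neg, ← Real.exp_neg, neg_neg, neg_neg, mul_assoc, ← Real.exp_add]

theorem log_det_conj {S : Matrix (Fin p) (Fin p) ℝ} (hS : IsUnit S) {d : Fin p → ℝ}
    (hd : ∀ j, 0 < d j) :
    Real.log (S * diagonal d * Sᵀ).det = Real.log (S * Sᵀ).det + ∑ j, Real.log (d j) := by
  have hS' : S.det ≠ 0 := ((isUnit_iff_isUnit_det _).1 hS).ne_zero
  rw [det_mul, det_mul, det_mul, det_transpose, det_diagonal, mul_right_comm,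
    Real.log_mul (by positivity) (Finset.prod_ne_zero_iff.2 fun j _ => (hd j).ne'),
    Real.log_prod (fun j _ => (hd j).ne')]

theorem log_det_spectral {S : Matrix (Fin p) (Fin p) ℝ} (hS : Sᵀ * S = 1) (a : Fin p → ℝ) :
    Real.log (S * diagonal (fun j => Real.exp (-a j)) * Sᵀ).det = -∑ j, a j := by
  rw [log_det_conj (isUnit_of_orthogonal hS) (fun j => Real.exp_pos _), mul_eq_one_comm.1 hS]
  simp

theorem mahalanobisSq_nonneg (Z : Matrix (Fin p) (Fin q) ℝ) {A : Matrix (Fin p) (Fin p) ℝ}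
    {B : Matrix (Fin q) (Fin q) ℝ} (hA : A.PosDef) (hB : B.PosDef) : 0 ≤ mahalanobisSq Z A B := by
  obtain ⟨S, hS, hA'⟩ := posDef_spectral hA
  obtain ⟨T, hT, hB'⟩ := posDef_spectral hB
  rw [hA', hB', mahalanobisSq_spectral hS hT]
  positivity

theorem sum_sq_eq_trace (Z : Matrix (Fin p) (Fin q) ℝ) :
    ∑ j, ∑ k, Z j k ^ 2 = trace (Zᵀ * Z) := by
  have := trace_diagonal_mul_transpose Z (fun _ => 1) (fun _ => 1)
  simpa using this.symm

/-- Both sides are Mahalanobis norms for identity covariances, i.e. the spectral formula with zero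
exponents. -/
theorem sum_sq_orthogonal {S : Matrix (Fin p) (Fin p) ℝ} {T : Matrix (Fin q) (Fin q) ℝ}
    (hS : Sᵀ * S = 1) (hT : Tᵀ * T = 1) (Z : Matrix (Fin p) (Fin q) ℝ) :
    ∑ j, ∑ k, (Sᵀ * Z * T) j k ^ 2 = ∑ j, ∑ k, Z j k ^ 2 := by
  have h := mahalanobisSq_spectral hS hT (fun _ => 0) (fun _ => 0) Z
  have h' := mahalanobisSq_spectral (S := (1 : Matrix (Fin p) (Fin p) ℝ))
    (T := (1 : Matrix (Fin q) (Fin q) ℝ)) (by simp) (by simp) (fun _ => 0) (fun _ => 0) Z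
  simp only [neg_zero, Real.exp_zero, diagonal_one, Matrix.mul_one, add_zero, mul_one,
    mul_eq_one_comm.1 hS, mul_eq_one_comm.1 hT, transpose_one, Matrix.one_mul] at h h'
  rw [← h, h']

end Spectral

/-! ### Hall-type inequality and coercivity -/

section LayerCake

variable {p q : ℕ}

theorem intervalIntegrable_step (x u v : ℝ) :
    IntervalIntegrable (fun s => if s < x then (1 : ℝ) else 0) volume u v := by
  have : Antitone (fun s => if s < x then (1 : ℝ) else 0) := by
    intro s t hst
    dsimp only
    split_ifs <;> linarith
  exact this.intervalIntegrable

theorem integral_step {R x : ℝ} (h1 : -R ≤ x) (h2 : x ≤ R) :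
    ∫ s in (-R)..R, (if s < x then (1 : ℝ) else 0) = x + R := by
  rw [← intervalIntegral.integral_add_adjacent_intervals (intervalIntegrable_step x (-R) x)
    (intervalIntegrable_step x x R)]
  have e1 : ∫ s in (-R)..x, (if s < x then (1 : ℝ) else 0) = ∫ s in (-R)..x, (1 : ℝ) := by
    -- The endpoint `x` lies in the interval but not in the step, so the integrands agree only off
    -- one point.
    refine intervalIntegral.integral_congr_ae ?_
    have : ∀ᵐ s ∂(volume : Measure ℝ), s ≠ x := by
      simp [ae_iff]
    filter_upwards [this] with s hs hs'
    rw [Set.uIoc_of_le h1] at hs'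
    rw [if_pos (lt_of_le_of_ne hs'.2 hs)]
  have e2 : ∫ s in x..R, (if s < x then (1 : ℝ) else 0) = ∫ s in x..R, (0 : ℝ) := by
    refine intervalIntegral.integral_congr fun s hs => ?_
    rw [Set.uIcc_of_le h2] at hs
    exact if_neg (not_lt.2 hs.1)
  rw [e1, e2]
  simp

/-- The layer-cake principle: a comparison of step functions integrates to a comparison of their
thresholds. -/
theorem sum_le_sum_of_step_le {ι κ : Type*} [Fintype ι] [Fintype κ] (c x : ι → ℝ) (c' y : κ → ℝ)
    (hc : ∑ i, c i = ∑ i, c' i)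
    (h : ∀ s : ℝ, ∑ i, c i * (if s < x i then 1 else 0) ≤ ∑ i, c' i * (if s < y i then 1 else 0)) :
    ∑ i, c i * x i ≤ ∑ i, c' i * y i := by
  -- A window [-R, R] containing all thresholds; its contribution R times the total weight cancels
  -- at the end because the total weights agree.
  set R := ∑ i, |x i| + ∑ i, |y i| with hR
  have hx : ∀ i, |x i| ≤ R := fun i => by
    have h1 := Finset.single_le_sum (f := fun i => |x i|) (fun i _ => abs_nonneg _)
      (Finset.mem_univ i)
    have h2 : 0 ≤ ∑ i, |y i| := by positivity
    linarith
  have hy : ∀ i, |y i| ≤ R := fun i => by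
    have h1 := Finset.single_le_sum (f := fun i => |y i|) (fun i _ => abs_nonneg _)
      (Finset.mem_univ i)
    have h2 : 0 ≤ ∑ i, |x i| := by positivity
    linarith
  have hR0 : 0 ≤ R := by positivity
  have key : ∫ s in (-R)..R, ∑ i, c i * (if s < x i then (1 : ℝ) else 0) ≤
      ∫ s in (-R)..R, ∑ i, c' i * (if s < y i then (1 : ℝ) else 0) := by
    refine intervalIntegral.integral_mono_on (by linarith) ?_ ?_ (fun s _ => h s)
    · simpa only [Finset.sum_fn] using IntervalIntegrable.sum Finset.univ
        fun i _ => (intervalIntegrable_step (x i) (-R) R).const_mul (c i)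
    · simpa only [Finset.sum_fn] using IntervalIntegrable.sum Finset.univ
        fun i _ => (intervalIntegrable_step (y i) (-R) R).const_mul (c' i)
  rw [intervalIntegral.integral_finsetSum
      (fun i _ => (intervalIntegrable_step _ _ _).const_mul _),
    intervalIntegral.integral_finsetSum
      (fun i _ => (intervalIntegrable_step _ _ _).const_mul _)] at key
  simp only [intervalIntegral.integral_const_mul] at key
  rw [Finset.sum_congr rfl (fun i _ => by
      rw [integral_step (neg_le_of_abs_le (hx i)) (le_of_abs_le (hx i)), mul_add]),
    Finset.sum_congr (g := fun i => c' i * y i + c' i * R) rfl (fun i _ => by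
      rw [integral_step (neg_le_of_abs_le (hy i)) (le_of_abs_le (hy i)), mul_add]),
    Finset.sum_add_distrib, Finset.sum_add_distrib, ← Finset.sum_mul, ← Finset.sum_mul, hc] at key
  linarith

/-- Hall-type bound: if `a j + b k ≤ φ` along the edges of a bipartite graph with strict expansion,
then the weighted total is at most `p * q * φ`, with a gain equal to the spread. -/
theorem weighted_sum_add_spread_le (hq : 0 < q) (a : Fin p → ℝ) (b : Fin q → ℝ) (G : Fin p → Fin q → Prop)
    (φ : ℝ) (hφ : ∀ j k, G j k → a j + b k ≤ φ)
    (hG : ∀ (J : Finset (Fin p)) (K : Finset (Fin q)), J.Nonempty → K.Nonempty →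
      (∀ j ∈ J, ∀ k ∈ K, ¬ G j k) → q * J.card + p * K.card < p * q)
    (j₀ j₁ : Fin p) :
    q * ∑ j, a j + p * ∑ k, b k + (a j₀ - a j₁) ≤ p * q * φ := by
  -- The spread is built in by one extra index of weight 1 on each side, with threshold `a j₀` on
  -- the left and `a j₁` on the right; both total weights are pq + 1.
  have key := sum_le_sum_of_step_le
    (Sum.elim (fun _ : Fin p => (q : ℝ)) (fun _ : Unit => 1)) (Sum.elim a fun _ => a j₀)
    (Sum.elim (fun _ : Fin q => (p : ℝ)) (fun _ : Unit => 1)) (Sum.elim (fun k => φ - b k) fun _ => a j₁)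
    (by simp [mul_comm]) ?_
  · simp only [Fintype.sum_sum_type, Sum.elim_inl, Sum.elim_inr, ← Finset.mul_sum,
      Finset.sum_sub_distrib] at key
    simp at key
    linarith
  · intro s
    simp only [Fintype.sum_sum_type, Sum.elim_inl, Sum.elim_inr, ← Finset.mul_sum]
    simp only [Finset.univ_unique, Finset.sum_singleton, one_mul]
    set J := Finset.univ.filter fun j => s < a j with hJ
    set K := Finset.univ.filter fun k => s < φ - b k with hK
    have hKc : (Kᶜ).card = q - K.card := by rw [Finset.card_compl, Fintype.card_fin]
    have hKle : K.card ≤ q := by simpa using K.card_le_univ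
    have hJle : J.card ≤ p := by simpa using J.card_le_univ
    -- At level s, an edge from J = {a > s} to the complement of K would have a j + b k > φ.
    have hno : ∀ j ∈ J, ∀ k ∈ Kᶜ, ¬ G j k := by
      intro j hj k hk hjk
      have := hφ j k hjk
      simp only [hJ, hK, Finset.mem_filter, Finset.mem_univ, true_and, Finset.mem_compl,
        not_lt] at hj hk
      linarith
    -- Expansion gives q|J| < p|K|, and the strict inequality of integers leaves room for the extra
    -- indicator at `j₀`. The degenerate cases are J empty and K everything; in the latter, if `j₁`
    -- is not in J, then J misses a row and q ≥ 1 units are left over.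
    have hmain : q * J.card + (if s < a j₀ then 1 else 0) ≤
        p * K.card + (if s < a j₁ then 1 else 0) := by
      rcases J.eq_empty_or_nonempty with hJe | hJn
      · have h0 : ¬ s < a j₀ := fun h => by
          have : j₀ ∈ J := by simp [hJ, h]
          simp [hJe] at this
        simp [hJe, h0]
      · rcases (Kᶜ).eq_empty_or_nonempty with hKe | hKn
        · have hKq : K.card = q := by rw [hKe, Finset.card_empty] at hKc; omega
          by_cases h1 : s < a j₁
          · simp only [h1, if_true, hKq]
            have : q * J.card ≤ p * q := by rw [mul_comm p]; exact Nat.mul_le_mul_left _ hJle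
            split_ifs <;> omega
          · have hlt : J.card < p := by
              have : J ⊂ Finset.univ := by
                rw [Finset.ssubset_univ_iff]
                intro h
                have : j₁ ∈ J := by rw [h]; simp
                simp [hJ] at this
                exact h1 this
              simpa using Finset.card_lt_card this
            have : q * J.card + q ≤ p * q := by
              calc q * J.card + q = q * (J.card + 1) := by ring
                _ ≤ q * p := Nat.mul_le_mul_left _ hlt
                _ = p * q := mul_comm _ _
            rw [hKq]
            split_ifs <;> omega
        · have h2 := hG J Kᶜ hJn hKn hno
          have h3 : p * (Kᶜ).card + p * K.card = p * q := by
            rw [← mul_add, hKc]; congr 1; omega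
          split_ifs <;> omega
    have e1 : ∑ j, (if s < a j then (1 : ℝ) else 0) = J.card := by simp [hJ]
    have e2 : ∑ k, (if s < φ - b k then (1 : ℝ) else 0) = K.card := by simp only [Finset.sum_boole, hK]
    change q * ∑ j, (if s < a j then (1 : ℝ) else 0) + (if s < a j₀ then 1 else 0) ≤
      p * ∑ k, (if s < φ - b k then (1 : ℝ) else 0) + (if s < a j₁ then 1 else 0)
    rw [e1, e2]
    exact_mod_cast hmain

/-- A nonnegative `p × q` array is `ε`-expanding if every block `J × K` with
`p * q ≤ q * |J| + p * |K|` contains an entry that is at least `ε`. -/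
def IsExpanding (ε : ℝ) (c : Fin p → Fin q → ℝ) : Prop :=
  ∀ (J : Finset (Fin p)) (K : Finset (Fin q)), J.Nonempty → K.Nonempty →
    p * q ≤ q * J.card + p * K.card → ∃ j ∈ J, ∃ k ∈ K, ε ≤ c j k

theorem IsExpanding.mono {ε ε' : ℝ} {c c' : Fin p → Fin q → ℝ} (h : IsExpanding ε c)
    (hε : ε' ≤ ε) (hc : ∀ j k, c j k ≤ c' j k) : IsExpanding ε' c' := by
  intro J K hJ hK hJK
  obtain ⟨j, hj, k, hk, hjk⟩ := h J K hJ hK hJK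
  exact ⟨j, hj, k, hk, hε.trans (hjk.trans (hc j k))⟩

theorem IsExpanding.const_mul {ε t : ℝ} {c : Fin p → Fin q → ℝ} (h : IsExpanding ε c)
    (ht : 0 ≤ t) : IsExpanding (t * ε) (fun j k => t * c j k) := by
  intro J K hJ hK hJK
  obtain ⟨j, hj, k, hk, hjk⟩ := h J K hJ hK hJK
  exact ⟨j, hj, k, hk, mul_le_mul_of_nonneg_left hjk ht⟩

/-- Coercivity of the likelihood in spectral coordinates. -/
theorem exists_bound_of_isExpanding (hp : 0 < p) (hq : 0 < q) {ε : ℝ} (hε : 0 < ε) (C₀ : ℝ) :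
    ∃ C : ℝ, ∀ (a : Fin p → ℝ) (b : Fin q → ℝ) (c : Fin p → Fin q → ℝ), (∀ j k, 0 ≤ c j k) →
      IsExpanding ε c →
      ∑ j, ∑ k, c j k * Real.exp (a j + b k) - (q * ∑ j, a j + p * ∑ k, b k) ≤ C₀ →
      ∀ j k, |a j + b k| ≤ C := by
  have hp' : (0 : ℝ) < p := by exact_mod_cast hp
  have hq' : (0 : ℝ) < q := by exact_mod_cast hq
  set N : ℝ := p * q with hN
  have hN0 : 0 < N := by positivity
  -- The constant for which N log(F/ε) ≤ F/2 + κ, from log x ≤ x - 1 at x = F/(2N).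
  set κ := N * Real.log (2 * N / ε) - N with hκ
  set C₁ := C₀ + κ with hC₁
  refine ⟨|C₀| / N + |C₁| / N + |κ| / N + 2 * |C₁|, fun a b c hc hG hF j k => ?_⟩
  set F := ∑ j, ∑ k, c j k * Real.exp (a j + b k) with hFdef
  have hle : ∀ j k, c j k * Real.exp (a j + b k) ≤ F := fun j k =>
    (Finset.single_le_sum (f := fun k => c j k * Real.exp (a j + b k))
      (fun k _ => mul_nonneg (hc j k) (Real.exp_pos _).le) (Finset.mem_univ k)).trans
    (Finset.single_le_sum (f := fun j => ∑ k, c j k * Real.exp (a j + b k))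
      (fun j _ => Finset.sum_nonneg fun k _ => mul_nonneg (hc j k) (Real.exp_pos _).le)
      (Finset.mem_univ j))
  have hF0 : 0 < F := by
    obtain ⟨j, -, k, -, hjk⟩ := hG Finset.univ Finset.univ ⟨⟨0, hp⟩, Finset.mem_univ _⟩
      ⟨⟨0, hq⟩, Finset.mem_univ _⟩ (by simp [mul_comm])
    exact lt_of_lt_of_le (mul_pos (hε.trans_le hjk) (Real.exp_pos _)) (hle j k)
  -- No single term exceeds the total F, so log(F/ε) bounds a j + b k wherever c j k ≥ ε.
  set φ := Real.log (F / ε) with hφ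
  have hφle : ∀ j k, ε ≤ c j k → a j + b k ≤ φ := by
    intro j k hjk
    rw [hφ, Real.le_log_iff_exp_le (by positivity), le_div_iff₀ hε, mul_comm]
    exact (mul_le_mul_of_nonneg_right hjk (Real.exp_pos _).le).trans (hle j k)
  have hNφ : N * φ ≤ F / 2 + κ := by
    have h1 : φ = Real.log (F / (2 * N)) + Real.log (2 * N / ε) := by
      rw [← Real.log_mul (by positivity) (by positivity), hφ]
      congr 1
      field_simp
    have h2 := Real.log_le_sub_one_of_pos (x := F / (2 * N)) (by positivity)
    have h3 : N * Real.log (F / (2 * N)) ≤ N * (F / (2 * N) - 1) :=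
      mul_le_mul_of_nonneg_left h2 hN0.le
    have h4 : N * (F / (2 * N) - 1) = F / 2 - N := by field_simp
    rw [h1, mul_add, hκ]
    linarith
  set L := q * ∑ j, a j + p * ∑ k, b k with hL
  have hsa : ∀ j₀ j₁, L + (a j₀ - a j₁) ≤ N * φ :=
    weighted_sum_add_spread_le hq a b (fun j k => ε ≤ c j k) φ hφle (by
      intro J K hJ hK h
      by_contra! hcon
      obtain ⟨j, hj, k, hk, hjk⟩ := hG J K hJ hK hcon
      exact h j hj k hk hjk)
  have hsb : ∀ k₀ k₁, L + (b k₀ - b k₁) ≤ N * φ := by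
    intro k₀ k₁
    have := weighted_sum_add_spread_le hp b a (fun k j => ε ≤ c j k) φ
      (fun k j h => by rw [add_comm]; exact hφle j k h) (by
      intro K J hK hJ h
      by_contra! hcon
      obtain ⟨j, hj, k, hk, hjk⟩ := hG J K hJ hK (by linarith [mul_comm p q])
      exact h k hk j hj hjk) k₀ k₁
    rw [hL, hN]
    linarith [mul_comm (p : ℝ) q]
  have hLsum : L = ∑ j', ∑ k', (a j' + b k') := by
    simp only [Finset.sum_add_distrib, Finset.sum_const, Finset.card_univ, Fintype.card_fin,
      nsmul_eq_mul, hL, ← Finset.mul_sum]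
  -- From F - L ≤ C₀ and L + spread ≤ F/2 + κ follows F/2 + spread ≤ C₁. This bounds the spreads of
  -- a and of b separately; adding them gives the factor 2.
  have hspr : ∀ j' k', |(a j + b k) - (a j' + b k')| ≤ 2 * |C₁| := by
    intro j' k'
    have := le_abs_self C₁
    rw [abs_le]
    constructor <;> linarith [hsa j j', hsa j' j, hsb k k', hsb k' k]
  have hdev : |N * (a j + b k) - L| ≤ N * (2 * |C₁|) := by
    have e : N * (a j + b k) - L = ∑ j' : Fin p, ∑ k' : Fin q, ((a j + b k) - (a j' + b k')) := by
      rw [hLsum]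
      simp only [Finset.sum_sub_distrib, Finset.sum_const, Finset.card_univ, Fintype.card_fin,
        nsmul_eq_mul]
      rw [hN]; ring
    rw [e]
    calc |∑ j' : Fin p, ∑ k' : Fin q, ((a j + b k) - (a j' + b k'))|
        ≤ ∑ j' : Fin p, ∑ k' : Fin q, |(a j + b k) - (a j' + b k')| :=
          (Finset.abs_sum_le_sum_abs _ _).trans
            (Finset.sum_le_sum fun _ _ => Finset.abs_sum_le_sum_abs _ _)
      _ ≤ ∑ j' : Fin p, ∑ k' : Fin q, 2 * |C₁| :=
          Finset.sum_le_sum fun _ _ => Finset.sum_le_sum fun _ _ => hspr _ _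
      _ = N * (2 * |C₁|) := by simp [hN, mul_assoc]
  have hLabs : |L| ≤ |C₀| + |C₁| + |κ| := by
    have h1 := hsa j j
    have := le_abs_self C₁
    have := le_abs_self C₀
    have := le_abs_self κ
    have := abs_nonneg C₁
    have := abs_nonneg C₀
    have := abs_nonneg κ
    rw [abs_le]
    constructor <;> linarith
  have : N * |a j + b k| ≤ N * (|C₀| / N + |C₁| / N + |κ| / N + 2 * |C₁|) := by
    have e : N * (|C₀| / N + |C₁| / N + |κ| / N + 2 * |C₁|) =
        |C₀| + |C₁| + |κ| + N * (2 * |C₁|) := by field_simp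
    rw [e, ← abs_of_pos hN0, ← abs_mul, abs_of_pos hN0]
    have := abs_sub_abs_le_abs_sub (N * (a j + b k)) L
    linarith
  exact le_of_mul_le_mul_left this hN0

end LayerCake

/-! ### Estimating equations and minima of the likelihood -/

section Likelihood

variable {n p q : ℕ}

theorem pos_of_posDef_conj_diagonal {S : Matrix (Fin p) (Fin p) ℝ} (hS : IsUnit S) {d : Fin p → ℝ}
    (h : (S * diagonal d * Sᵀ).PosDef) (j : Fin p) : 0 < d j := by
  have hS' : IsUnit S.det := (isUnit_iff_isUnit_det _).1 hS
  have h1 := h.mul_mul_conjTranspose_same (B := S⁻¹)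
    (Matrix.vecMul_injective_of_isUnit ((isUnit_nonsing_inv_iff).2 hS))
  have h2 : Sᵀ * S⁻¹ᵀ = 1 := by rw [← transpose_mul, nonsing_inv_mul _ hS', transpose_one]
  have h3 : S⁻¹ * (S * diagonal d * Sᵀ) * S⁻¹ᴴ = diagonal d := by
    rw [conjTranspose_eq_transpose_of_trivial]
    calc S⁻¹ * (S * diagonal d * Sᵀ) * S⁻¹ᵀ = (S⁻¹ * S) * diagonal d * (Sᵀ * S⁻¹ᵀ) := by
          simp only [Matrix.mul_assoc]
      _ = _ := by rw [h2, nonsing_inv_mul _ hS', Matrix.one_mul, Matrix.mul_one]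
  rw [h3] at h1
  exact posDef_diagonal_iff.1 h1 j

theorem conj_injective {S A B : Matrix (Fin p) (Fin p) ℝ} (hS : IsUnit S)
    (h : S * A * Sᵀ = S * B * Sᵀ) : A = B := by
  have hS' : IsUnit S.det := (isUnit_iff_isUnit_det _).1 hS
  have h2 : Sᵀ * S⁻¹ᵀ = 1 := by rw [← transpose_mul, nonsing_inv_mul _ hS', transpose_one]
  have h3 : ∀ C, S⁻¹ * (S * C * Sᵀ) * S⁻¹ᵀ = C := fun C => by
    calc S⁻¹ * (S * C * Sᵀ) * S⁻¹ᵀ = (S⁻¹ * S) * C * (Sᵀ * S⁻¹ᵀ) := by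
          simp only [Matrix.mul_assoc]
      _ = _ := by rw [h2, nonsing_inv_mul _ hS', Matrix.one_mul, Matrix.mul_one]
  rw [← h3 A, h, h3]

theorem conj_mul_inv_mul_transpose {S : Matrix (Fin p) (Fin p) ℝ} {T : Matrix (Fin q) (Fin q) ℝ}
    (hT : IsUnit T) (W : Matrix (Fin p) (Fin q) ℝ) :
    (S * W * Tᵀ) * (T * Tᵀ)⁻¹ * (S * W * Tᵀ)ᵀ = S * (W * Wᵀ) * Sᵀ := by
  have hT' : IsUnit T.det := (isUnit_iff_isUnit_det _).1 hT
  have h2 : Tᵀ * Tᵀ⁻¹ = 1 := mul_nonsing_inv _ (by rwa [det_transpose])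
  rw [Matrix.mul_inv_rev]
  simp only [transpose_mul, transpose_transpose]
  calc S * W * Tᵀ * (Tᵀ⁻¹ * T⁻¹) * (T * (Wᵀ * Sᵀ))
      = S * W * (Tᵀ * Tᵀ⁻¹) * (T⁻¹ * T) * Wᵀ * Sᵀ := by simp only [Matrix.mul_assoc]
    _ = _ := by
      rw [h2, nonsing_inv_mul _ hT']
      simp only [Matrix.mul_assoc, Matrix.one_mul]

theorem conj_unit {S : Matrix (Fin p) (Fin p) ℝ} {T : Matrix (Fin q) (Fin q) ℝ}
    (hS : IsUnit S) (hT : IsUnit T) (Z : Matrix (Fin p) (Fin q) ℝ) :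
    S * (S⁻¹ * Z * T⁻¹ᵀ) * Tᵀ = Z := by
  have hS' : IsUnit S.det := (isUnit_iff_isUnit_det _).1 hS
  have hT' : IsUnit T.det := (isUnit_iff_isUnit_det _).1 hT
  have h2 : T⁻¹ᵀ * Tᵀ = 1 := by rw [← transpose_mul, mul_nonsing_inv _ hT', transpose_one]
  calc S * (S⁻¹ * Z * T⁻¹ᵀ) * Tᵀ = (S * S⁻¹) * Z * (T⁻¹ᵀ * Tᵀ) := by simp only [Matrix.mul_assoc]
    _ = Z := by rw [h2, mul_nonsing_inv _ hS', Matrix.one_mul, Matrix.mul_one]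

/-- With total weight zero, the convention 0⁻¹ = 0 would make the row covariance vanish,
contradicting positive definiteness. -/
theorem sum_weights_pos (hp : 0 < p) {X : Sample n p q} {v : Fin n → ℝ} {θ : Params p q}
    (hv : ∀ i, 0 ≤ v i) (h : IsWeightedMLE X v θ) : 0 < ∑ i, v i := by
  refine lt_of_le_of_ne (Finset.sum_nonneg fun i _ => hv i) fun h0 => ?_
  have h1 := h.2.1
  rw [← h0, mul_zero, _root_.inv_zero, zero_smul] at h1
  have h2 := θ.row_posDef.diag_pos (i := ⟨0, hp⟩)
  rw [h1] at h2
  simp at h2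

/-- In coordinates where both covariances are the identity, the estimating equations say that the
row sums and the column sums of the mean squares are `q` and `p`. -/
theorem exists_normal_coordinates {X : Sample n p q} {v : Fin n → ℝ}
    {θ : Params p q} (hp : 0 < p) (hq : 0 < q) (hv : ∀ i, 0 ≤ v i) (h : IsWeightedMLE X v θ)
    {S : Matrix (Fin p) (Fin p) ℝ} {T : Matrix (Fin q) (Fin q) ℝ} (hS : IsUnit S) (hT : IsUnit T)
    (hr : θ.row = S * Sᵀ) (hc : θ.col = T * Tᵀ) :
    (∀ j, ∑ i, v i * ∑ k, (S⁻¹ * (X i - θ.loc) * T⁻¹ᵀ) j k ^ 2 = q * ∑ i, v i) ∧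
    (∀ k, ∑ i, v i * ∑ j, (S⁻¹ * (X i - θ.loc) * T⁻¹ᵀ) j k ^ 2 = p * ∑ i, v i) := by
  have hs := sum_weights_pos hp hv h
  have hp' : (0 : ℝ) < p := by exact_mod_cast hp
  have hq' : (0 : ℝ) < q := by exact_mod_cast hq
  set W := fun i => S⁻¹ * (X i - θ.loc) * T⁻¹ᵀ with hW
  have hXW : ∀ i, X i - θ.loc = S * W i * Tᵀ := fun i => (conj_unit hS hT _).symm
  constructor
  · have h1 := h.2.1
    rw [hc, hr] at h1
    simp only [hXW, conj_mul_inv_mul_transpose hT] at h1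
    have h2 : S * (1 : Matrix (Fin p) (Fin p) ℝ) * Sᵀ =
        S * (((q : ℝ) * ∑ i, v i)⁻¹ • ∑ i, v i • (W i * (W i)ᵀ)) * Sᵀ := by
      rw [Matrix.mul_one]
      conv_lhs => rw [h1]
      simp only [Matrix.mul_smul, Matrix.smul_mul, Matrix.mul_sum, Matrix.sum_mul]
    have h3 := conj_injective hS h2
    intro j
    have h4 := congrFun (congrFun h3 j) j
    simp only [one_apply_eq, Matrix.smul_apply, Matrix.sum_apply, mul_apply, transpose_apply, smul_eq_mul,
      ← sq] at h4
    field_simp at h4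
    exact h4.symm
  · have h1 := h.2.2
    rw [hc, hr] at h1
    have hXW' : ∀ i, (X i - θ.loc)ᵀ = T * (W i)ᵀ * Sᵀ := fun i => by
      rw [hXW]; simp only [transpose_mul, transpose_transpose, Matrix.mul_assoc]
    have hXW'' : ∀ i, X i - θ.loc = (T * (W i)ᵀ * Sᵀ)ᵀ := fun i => by
      rw [← hXW', transpose_transpose]
    have h1' : T * Tᵀ = ((p : ℝ) * ∑ i, v i)⁻¹ • ∑ i, v i • (T * ((W i)ᵀ * (W i)ᵀᵀ) * Tᵀ) := by
      rw [h1]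
      congr 1
      refine Finset.sum_congr rfl fun i _ => ?_
      rw [← conj_mul_inv_mul_transpose hS, ← hXW'', ← hXW']
    have h2 : T * (1 : Matrix (Fin q) (Fin q) ℝ) * Tᵀ =
        T * (((p : ℝ) * ∑ i, v i)⁻¹ • ∑ i, v i • ((W i)ᵀ * (W i)ᵀᵀ)) * Tᵀ := by
      rw [Matrix.mul_one, h1']
      simp only [Matrix.mul_smul, Matrix.smul_mul, Matrix.mul_sum, Matrix.sum_mul]
    have h3 := conj_injective hT h2
    intro k
    have h4 := congrFun (congrFun h3 k) k
    simp only [one_apply_eq, Matrix.smul_apply, Matrix.sum_apply, mul_apply, transpose_apply, smul_eq_mul,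
      ← sq] at h4
    field_simp at h4
    exact h4.symm

/-- A solution of the estimating equations is a global minimum of the likelihood, and its mean
squared Mahalanobis distance is `p * q`. -/
theorem mle_le_likelihood_of_loc {X : Sample n p q} {v : Fin n → ℝ} {θ : Params p q}
    (hp : 0 < p) (hq : 0 < q) (hv : ∀ i, 0 ≤ v i) (h : IsWeightedMLE X v θ)
    {A : Matrix (Fin p) (Fin p) ℝ} {B : Matrix (Fin q) (Fin q) ℝ} (hA : A.PosDef)
    (hB : B.PosDef) :
    p * q + objective θ ≤ (∑ i, v i)⁻¹ * ∑ i, v i * mahalanobisSq (X i - θ.loc) A B +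
      (p * Real.log B.det + q * Real.log A.det) := by
  have hs := sum_weights_pos hp hv h
  -- Bases in which the covariances of `θ` are identities and the competitors `A`, `B` are diagonal
  -- reduce the claim to scalars.
  obtain ⟨S, D, hS, hr, hA'⟩ := simultaneous_diagonalization θ.row_posDef hA.isHermitian
  obtain ⟨T, E, hT, hc, hB'⟩ := simultaneous_diagonalization θ.col_posDef hB.isHermitian
  have hD : ∀ j, 0 < D j := pos_of_posDef_conj_diagonal hS (hA' ▸ hA)
  have hE : ∀ k, 0 < E k := pos_of_posDef_conj_diagonal hT (hB' ▸ hB)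
  obtain ⟨h1, h2⟩ := exists_normal_coordinates hp hq hv h hS hT hr hc
  set W := fun i => S⁻¹ * (X i - θ.loc) * T⁻¹ᵀ with hW
  have hXW : ∀ i, X i - θ.loc = S * W i * Tᵀ := fun i => (conj_unit hS hT _).symm
  rw [objective, hr, hc, hA', hB', log_det_conj hS hD, log_det_conj hT hE]
  have h3 : ∀ i, mahalanobisSq (X i - θ.loc) (S * diagonal D * Sᵀ) (T * diagonal E * Tᵀ) =
      ∑ j, ∑ k, W i j k ^ 2 * (D j)⁻¹ * (E k)⁻¹ := fun i => by
    rw [hXW, mahalanobisSq_conj hS hT (fun j => (hD j).ne') (fun k => (hE k).ne')]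
  simp only [h3]
  -- Termwise 1/x ≥ 1 - log x with x = D j * E k. The lower bound splits into a part depending on j
  -- and a part depending on k, which is what the estimating equations can evaluate.
  have h4 : ∀ i, v i * ∑ j, ∑ k, W i j k ^ 2 * (1 - Real.log (D j) - Real.log (E k)) ≤
      v i * ∑ j, ∑ k, W i j k ^ 2 * (D j)⁻¹ * (E k)⁻¹ := by
    intro i
    refine mul_le_mul_of_nonneg_left (Finset.sum_le_sum fun j _ => Finset.sum_le_sum fun k _ => ?_)
      (hv i)
    rw [mul_assoc]
    refine mul_le_mul_of_nonneg_left ?_ (sq_nonneg _)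
    have := Real.one_sub_inv_le_log_of_pos (mul_pos (hD j) (hE k))
    rw [Real.log_mul (hD j).ne' (hE k).ne', mul_inv] at this
    linarith
  have h5 := Finset.sum_le_sum fun i (_ : i ∈ Finset.univ) => h4 i
  -- The row sums evaluate the part with D and the column sums the part with E, so the lower bound
  -- is explicit.
  have h6 : ∑ i, v i * ∑ j, ∑ k, W i j k ^ 2 * (1 - Real.log (D j) - Real.log (E k)) =
      (∑ i, v i) * (p * q - q * ∑ j, Real.log (D j) - p * ∑ k, Real.log (E k)) := by
    have e : ∀ i, v i * ∑ j, ∑ k, W i j k ^ 2 * (1 - Real.log (D j) - Real.log (E k)) =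
        (∑ j, (1 - Real.log (D j)) * (v i * ∑ k, W i j k ^ 2)) -
          ∑ k, Real.log (E k) * (v i * ∑ j, W i j k ^ 2) := by
      intro i
      simp only [Finset.mul_sum]
      rw [Finset.sum_comm (s := (Finset.univ : Finset (Fin q))), ← Finset.sum_sub_distrib]
      refine Finset.sum_congr rfl fun j _ => ?_
      rw [← Finset.sum_sub_distrib]
      refine Finset.sum_congr rfl fun k _ => ?_
      ring
    simp only [e]
    rw [Finset.sum_sub_distrib, Finset.sum_comm, Finset.sum_comm (t := (Finset.univ : Finset (Fin q)))]
    simp only [← Finset.mul_sum, hW] at h1 h2 ⊢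
    simp only [h1, h2, Finset.sum_sub_distrib, ← Finset.sum_mul]
    simp
    ring
  rw [h6] at h5
  have h7 := mul_le_mul_of_nonneg_left h5 (inv_nonneg.2 hs.le)
  rw [← mul_assoc, inv_mul_cancel₀ hs.ne', one_mul] at h7
  linarith

/-- In normal coordinates the squared distance is the sum of the squared entries; add up the p row
identities, each equal to q times the total weight. -/
theorem sum_mahalanobisSq_mle {X : Sample n p q} {v : Fin n → ℝ} {θ : Params p q}
    (hp : 0 < p) (hq : 0 < q) (hv : ∀ i, 0 ≤ v i) (h : IsWeightedMLE X v θ) :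
    (∑ i, v i)⁻¹ * ∑ i, v i * mahalanobisSq (X i - θ.loc) θ.row θ.col = p * q := by
  have hs := sum_weights_pos hp hv h
  obtain ⟨S, D, hS, hr, -⟩ := simultaneous_diagonalization θ.row_posDef θ.row_posDef.isHermitian
  obtain ⟨T, E, hT, hc, -⟩ := simultaneous_diagonalization θ.col_posDef θ.col_posDef.isHermitian
  obtain ⟨h1, -⟩ := exists_normal_coordinates hp hq hv h hS hT hr hc
  have h3 : ∀ i, mahalanobisSq (X i - θ.loc) θ.row θ.col =
      ∑ j, ∑ k, (S⁻¹ * (X i - θ.loc) * T⁻¹ᵀ) j k ^ 2 := fun i => by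
    have := mahalanobisSq_conj hS hT (d := fun _ => 1) (e := fun _ => 1) (by simp) (by simp)
      (S⁻¹ * (X i - θ.loc) * T⁻¹ᵀ)
    rw [conj_unit hS hT] at this
    rw [hr, hc]
    simpa using this
  have h4 : ∑ i, v i * mahalanobisSq (X i - θ.loc) θ.row θ.col = ∑ _j : Fin p, q * ∑ i, v i := by
    rw [← Finset.sum_congr rfl fun j _ => h1 j, Finset.sum_comm]
    exact Finset.sum_congr rfl fun i _ => by rw [h3, Finset.mul_sum]
  rw [h4]
  simp
  field_simp

/-- Steiner's identity: the two sides differ by s⁻¹ (y - m s)², where y = ∑ v i * x i. Only the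
total weight s has to be positive. -/
theorem sum_mul_sub_sq_le {ι : Type*} [Fintype ι] (v x : ι → ℝ) (hs : 0 < ∑ i, v i) (m : ℝ) :
    ∑ i, v i * (x i - (∑ i, v i)⁻¹ * ∑ i, v i * x i) ^ 2 ≤ ∑ i, v i * (x i - m) ^ 2 := by
  set s := ∑ i, v i with hsdef
  set y := ∑ i, v i * x i with hy
  have e : ∀ m : ℝ, ∑ i, v i * (x i - m) ^ 2 = ∑ i, v i * x i ^ 2 - 2 * m * y + m ^ 2 * s := by
    intro m
    rw [hy, hsdef, Finset.mul_sum, Finset.mul_sum, ← Finset.sum_sub_distrib,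
      ← Finset.sum_add_distrib]
    exact Finset.sum_congr rfl fun i _ => by ring
  rw [e, e]
  have : (0 : ℝ) ≤ s⁻¹ * (y - m * s) ^ 2 := by positivity
  have h2 : s⁻¹ * (y - m * s) ^ 2 = s⁻¹ * y ^ 2 - 2 * m * y + m ^ 2 * s := by field_simp; ring
  have h3 : (s⁻¹ * y) ^ 2 * s = s⁻¹ * y ^ 2 := by field_simp
  rw [h3]
  linarith

/-- The weighted mean minimizes the weighted sum of squared distances. -/
theorem sum_mahalanobisSq_mean_le (X : Sample n p q) (v : Fin n → ℝ) (hs : 0 < ∑ i, v i)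
    {A : Matrix (Fin p) (Fin p) ℝ} {B : Matrix (Fin q) (Fin q) ℝ} (hA : A.PosDef)
    (hB : B.PosDef) (M : Matrix (Fin p) (Fin q) ℝ) :
    ∑ i, v i * mahalanobisSq (X i - (∑ i, v i)⁻¹ • ∑ i, v i • X i) A B ≤
      ∑ i, v i * mahalanobisSq (X i - M) A B := by
  obtain ⟨S, hS, hA'⟩ := posDef_spectral hA
  obtain ⟨T, hT, hB'⟩ := posDef_spectral hB
  rw [hA', hB']
  set a : Fin p → ℝ := fun j => -Real.log (hA.isHermitian.eigenvalues j)
  set b : Fin q → ℝ := fun j => -Real.log (hB.isHermitian.eigenvalues j)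
  have key : ∀ N : Matrix (Fin p) (Fin q) ℝ,
      ∑ i, v i * mahalanobisSq (X i - N) (S * diagonal (fun j => Real.exp (-a j)) * Sᵀ)
        (T * diagonal (fun k => Real.exp (-b k)) * Tᵀ) =
      ∑ j, ∑ k, (∑ i, v i * ((Sᵀ * X i * T) j k - (Sᵀ * N * T) j k) ^ 2) *
        Real.exp (a j + b k) := by
    intro N
    simp only [mahalanobisSq_spectral hS hT, Matrix.mul_sub, Matrix.sub_mul, Matrix.sub_apply,
      Finset.mul_sum, Finset.sum_mul]
    rw [Finset.sum_comm]
    refine Finset.sum_congr rfl fun j _ => ?_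
    rw [Finset.sum_comm]
    refine Finset.sum_congr rfl fun k _ => Finset.sum_congr rfl fun i _ => ?_
    ring
  rw [key, key]
  refine Finset.sum_le_sum fun j _ => Finset.sum_le_sum fun k _ =>
    mul_le_mul_of_nonneg_right ?_ (Real.exp_pos _).le
  have e : (Sᵀ * ((∑ i, v i)⁻¹ • ∑ i, v i • X i) * T) j k =
      (∑ i, v i)⁻¹ * ∑ i, v i * (Sᵀ * X i * T) j k := by
    simp only [Matrix.mul_smul, Matrix.smul_mul, Matrix.mul_sum, Matrix.sum_mul, Matrix.smul_apply,
      Matrix.sum_apply, smul_eq_mul]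
  rw [e]
  exact sum_mul_sub_sq_le v (fun i => (Sᵀ * X i * T) j k) hs _

/-- The weighted likelihood (up to constants, minus twice the logarithm, per unit of weight). -/
noncomputable def likelihood (X : Sample n p q) (v : Fin n → ℝ) (θ : Params p q) : ℝ :=
  (∑ i, v i)⁻¹ * ∑ i, v i * mahalanobisSq (X i - θ.loc) θ.row θ.col + objective θ

/-- The location of `θ` is the weighted mean, which is optimal for any fixed covariances. So the
comparison at the location of `θ` implies the comparison with every location. -/
theorem mle_le_likelihood {X : Sample n p q} {v : Fin n → ℝ} {θ : Params p q}
    (hp : 0 < p) (hq : 0 < q) (hv : ∀ i, 0 ≤ v i) (h : IsWeightedMLE X v θ) (η : Params p q) :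
    p * q + objective θ ≤ likelihood X v η := by
  have hs := sum_weights_pos hp hv h
  refine (mle_le_likelihood_of_loc hp hq hv h η.row_posDef η.col_posDef).trans ?_
  rw [likelihood, objective, h.1]
  exact add_le_add_left (mul_le_mul_of_nonneg_left
    (sum_mahalanobisSq_mean_le X v hs η.row_posDef η.col_posDef _) (inv_nonneg.2 hs.le)) _

theorem likelihood_mle {X : Sample n p q} {v : Fin n → ℝ} {θ : Params p q}
    (hp : 0 < p) (hq : 0 < q) (hv : ∀ i, 0 ≤ v i) (h : IsWeightedMLE X v θ) :
    likelihood X v θ = p * q + objective θ := by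
  rw [likelihood, sum_mahalanobisSq_mle hp hq hv h]

/-- t = 1/2 yields x ≥ log 2 > 0, which makes t = x admissible; then x - 1 ≤ log x forces x = 1. -/
theorem eq_one_of_forall_le {x : ℝ} (h : ∀ t : ℝ, 0 < t → x ≤ x / t + Real.log t) : x = 1 := by
  have h2 := h (1 / 2) (by norm_num)
  rw [one_div, Real.log_inv, div_inv_eq_mul] at h2
  have hx : 0 < x := by linarith [Real.log_pos one_lt_two]
  have h3 := h x hx
  rw [div_self hx.ne'] at h3
  by_contra hne
  linarith [Real.log_lt_sub_one_of_pos hx hne]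

/-- `A ↦ tr(A⁻¹ C) + log det A` has no critical minimum other than `A = C`. -/
theorem eq_of_forall_trace_add_log_det_le {A C : Matrix (Fin p) (Fin p) ℝ} (hA : A.PosDef)
    (hC : C.IsHermitian)
    (h : ∀ A' : Matrix (Fin p) (Fin p) ℝ, A'.PosDef →
      trace (A⁻¹ * C) + Real.log A.det ≤ trace (A'⁻¹ * C) + Real.log A'.det) : A = C := by
  obtain ⟨S, D, hS, hA', hC'⟩ := simultaneous_diagonalization hA hC
  have hS' : IsUnit S.det := (isUnit_iff_isUnit_det _).1 hS
  have h2 : Sᵀ * S⁻¹ᵀ = 1 := by rw [← transpose_mul, nonsing_inv_mul _ hS', transpose_one]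
  have htr : ∀ e : Fin p → ℝ, (∀ j, 0 < e j) →
      trace ((S * diagonal e * Sᵀ)⁻¹ * C) = ∑ j, D j / e j := by
    intro e he
    rw [inv_conj_diagonal hS (fun j => (he j).ne'), hC']
    calc trace (S⁻¹ᵀ * diagonal (fun j => (e j)⁻¹) * S⁻¹ * (S * diagonal D * Sᵀ))
        = trace (S⁻¹ᵀ * (diagonal (fun j => (e j)⁻¹) * (S⁻¹ * S) * diagonal D * Sᵀ)) := by
          simp only [Matrix.mul_assoc]
      _ = trace (diagonal (fun j => (e j)⁻¹) * diagonal D * (Sᵀ * S⁻¹ᵀ)) := by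
          rw [trace_mul_comm, nonsing_inv_mul _ hS', Matrix.mul_one]
          simp only [Matrix.mul_assoc]
      _ = _ := by
          rw [h2, Matrix.mul_one, diagonal_mul_diagonal, trace_diagonal]
          exact Finset.sum_congr rfl fun j _ => by rw [div_eq_inv_mul]
  have hA1 : A = S * diagonal (fun _ => 1) * Sᵀ := by
    rw [diagonal_one, Matrix.mul_one, hA']
  -- Vary one eigenvalue at a time. `C` is only symmetric here; positivity of `D j` comes out of the
  -- scalar lemma.
  have hD : ∀ j, D j = 1 := by
    intro j
    apply eq_one_of_forall_le
    intro t ht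
    have hpos : ∀ i, 0 < Function.update (fun _ : Fin p => (1 : ℝ)) j t i := by
      intro i
      rcases eq_or_ne i j with rfl | hij
      · simpa using ht
      · simp [hij]
    have h3 := h _ (posDef_conj_diagonal hS hpos)
    rw [htr _ hpos, log_det_conj hS hpos, hA1, htr _ (fun _ => one_pos),
      log_det_conj hS (fun _ => one_pos)] at h3
    have e1 : ∑ i, D i / Function.update (fun _ : Fin p => (1 : ℝ)) j t i =
        ∑ i, D i + (D j / t - D j) := by
      have e : ∀ i, D i / Function.update (fun _ : Fin p => (1 : ℝ)) j t i =
          D i + if i = j then D i / t - D i else 0 := by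
        intro i
        split_ifs with hij
        · rw [hij, Function.update_self]; ring
        · rw [Function.update_of_ne hij]; ring
      simp only [e, Finset.sum_add_distrib, Finset.sum_ite_eq', Finset.mem_univ, if_true]
    have e2 : ∑ i, Real.log (Function.update (fun _ : Fin p => (1 : ℝ)) j t i) = Real.log t := by
      rw [Finset.sum_eq_single j (fun i _ hi => by rw [Function.update_of_ne hi, Real.log_one])
        (by simp), Function.update_self]
    rw [e1, e2] at h3
    simp only [div_one, Real.log_one, Finset.sum_const_zero] at h3
    linarith
  rw [hA', hC', funext hD]
  simp

end Likelihood

/-! ### Existence of maximum likelihood estimates -/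

section Existence

variable {n p q : ℕ}

theorem isCompact_matrix_box (p q : ℕ) (R : ℝ) :
    IsCompact {Z : Matrix (Fin p) (Fin q) ℝ | ∀ j k, |Z j k| ≤ R} := by
  have h : IsCompact (Set.pi Set.univ fun _ : Fin p => Set.pi Set.univ fun _ : Fin q =>
      Set.Icc (-R) R) :=
    isCompact_univ_pi fun _ => isCompact_univ_pi fun _ => isCompact_Icc
  change @IsCompact (Fin p → Fin q → ℝ) _ {Z | ∀ j k, |Z j k| ≤ R}
  convert h using 1
  ext Z
  simp only [Set.mem_ofPred_eq, Set.mem_pi, Set.mem_univ, true_imp_iff, abs_le, Set.mem_Icc]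

theorem isCompact_vector_box (p : ℕ) (R : ℝ) :
    IsCompact {a : Fin p → ℝ | ∀ j, |a j| ≤ R} := by
  have h : IsCompact (Set.pi Set.univ fun _ : Fin p => Set.Icc (-R) R) :=
    isCompact_univ_pi fun _ => isCompact_Icc
  convert h using 1
  ext Z
  simp only [Set.mem_ofPred_eq, Set.mem_pi, Set.mem_univ, true_imp_iff, abs_le, Set.mem_Icc]

theorem isCompact_orthogonal (p : ℕ) : IsCompact {S : Matrix (Fin p) (Fin p) ℝ | Sᵀ * S = 1} := by
  refine (isCompact_matrix_box p p 1).of_isClosed_subset ?_ ?_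
  · exact isClosed_eq (by fun_prop) continuous_const
  · intro S hS j k
    have h1 := congrFun (congrFun (show Sᵀ * S = 1 from hS) k) k
    rw [one_apply_eq, mul_apply] at h1
    have h2 : S j k ^ 2 ≤ ∑ i, Sᵀ k i * S i k := by
      simp only [transpose_apply, ← sq]
      exact Finset.single_le_sum (f := fun i => S i k ^ 2) (fun i _ => sq_nonneg _)
        (Finset.mem_univ j)
    rw [h1] at h2
    exact abs_le_one_iff_mul_self_le_one.2 (by rwa [← sq])

/-- The covariance matrix with eigenvectors `S` and eigenvalues `exp (-a j)`. -/
noncomputable def spectralMatrix (S : Matrix (Fin p) (Fin p) ℝ) (a : Fin p → ℝ) :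
    Matrix (Fin p) (Fin p) ℝ :=
  S * diagonal (fun j => Real.exp (-a j)) * Sᵀ

theorem spectralMatrix_posDef {S : Matrix (Fin p) (Fin p) ℝ} (hS : Sᵀ * S = 1) (a : Fin p → ℝ) :
    (spectralMatrix S a).PosDef :=
  posDef_conj_diagonal (isUnit_of_orthogonal hS) fun _ => Real.exp_pos _

theorem spectralMatrix_sub_const (S : Matrix (Fin p) (Fin p) ℝ) (a : Fin p → ℝ) (t : ℝ) :
    spectralMatrix S (fun j => a j - t) = Real.exp t • spectralMatrix S a := by
  have : diagonal (fun j => Real.exp (-(a j - t))) =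
      Real.exp t • diagonal (fun j => Real.exp (-a j)) := by
    rw [← diagonal_smul]
    congr 1
    ext j
    simp only [Pi.smul_apply, smul_eq_mul]
    rw [← Real.exp_add]
    ring_nf
  rw [spectralMatrix, this]
  simp [spectralMatrix]

theorem spectralMatrix_inv {S : Matrix (Fin p) (Fin p) ℝ} (hS : Sᵀ * S = 1) (a : Fin p → ℝ) :
    (spectralMatrix S a)⁻¹ = spectralMatrix S (fun j => -a j) := by
  rw [spectralMatrix, inv_conj_diagonal (isUnit_of_orthogonal hS) (fun j => (Real.exp_pos _).ne'),
    orthogonal_inv hS, transpose_transpose]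
  simp only [spectralMatrix, ← Real.exp_neg]

/-- The profile likelihood at location `M` in spectral coordinates. -/
noncomputable def spectralLikelihood (X : Sample n p q) (v : Fin n → ℝ)
    (M : Matrix (Fin p) (Fin q) ℝ)
    (x : Matrix (Fin p) (Fin p) ℝ × Matrix (Fin q) (Fin q) ℝ × (Fin p → ℝ) × (Fin q → ℝ)) : ℝ :=
  ∑ j, ∑ k, ((∑ i, v i)⁻¹ * ∑ i, v i * (x.1ᵀ * (X i - M) * x.2.1) j k ^ 2) *
    Real.exp (x.2.2.1 j + x.2.2.2 k) - (q * ∑ j, x.2.2.1 j + p * ∑ k, x.2.2.2 k)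

theorem continuous_spectralLikelihood (X : Sample n p q) (v : Fin n → ℝ)
    (M : Matrix (Fin p) (Fin q) ℝ) : Continuous (spectralLikelihood X v M) := by
  unfold spectralLikelihood
  fun_prop

theorem spectralLikelihood_eq (X : Sample n p q) (v : Fin n → ℝ) (M : Matrix (Fin p) (Fin q) ℝ)
    {S : Matrix (Fin p) (Fin p) ℝ} {T : Matrix (Fin q) (Fin q) ℝ} (hS : Sᵀ * S = 1)
    (hT : Tᵀ * T = 1) (a : Fin p → ℝ) (b : Fin q → ℝ) :
    spectralLikelihood X v M (S, T, a, b) =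
      (∑ i, v i)⁻¹ * ∑ i, v i * mahalanobisSq (X i - M) (spectralMatrix S a) (spectralMatrix T b) +
        (p * Real.log (spectralMatrix T b).det + q * Real.log (spectralMatrix S a).det) := by
  rw [spectralMatrix, spectralMatrix, log_det_spectral hS, log_det_spectral hT, spectralLikelihood]
  simp only [mahalanobisSq_spectral hS hT]
  have e : ∑ j, ∑ k, ((∑ i, v i)⁻¹ * ∑ i, v i * (Sᵀ * (X i - M) * T) j k ^ 2) *
      Real.exp (a j + b k) =
      (∑ i, v i)⁻¹ * ∑ i, v i * ∑ j, ∑ k, (Sᵀ * (X i - M) * T) j k ^ 2 * Real.exp (a j + b k) := by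
    rw [Finset.mul_sum]
    simp only [Finset.mul_sum, Finset.sum_mul]
    symm
    rw [Finset.sum_comm]
    refine Finset.sum_congr rfl fun j _ => ?_
    rw [Finset.sum_comm]
    exact Finset.sum_congr rfl fun k _ => Finset.sum_congr rfl fun i _ => by ring
  rw [e]
  ring

/-- The observations in `I` are in `ε`-general position: in all orthogonal coordinates, the mean
squared differences form an `ε`-expanding array. -/
def InGeneralPosition (ε : ℝ) (X : Sample n p q) (I : Finset (Fin n)) : Prop :=
  ∀ (S : Matrix (Fin p) (Fin p) ℝ) (T : Matrix (Fin q) (Fin q) ℝ), Sᵀ * S = 1 → Tᵀ * T = 1 →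
    IsExpanding ε fun j k => ∑ i ∈ I, ∑ i' ∈ I, (Sᵀ * (X i - X i') * T) j k ^ 2

/-- (y i - y i')² ≤ 2 (y i - m)² + 2 (y i' - m)², and |I| ≤ n accounts for the factor 4n. The left
side does not involve the centre m, so clean observations control the scatter about a location that
may be corrupted. -/
theorem sum_sum_sub_sq_le {I : Finset (Fin n)} {v y : Fin n → ℝ} {δ : ℝ} (hδ : 0 < δ)
    (hv : ∀ i, 0 ≤ v i) (hvI : ∀ i ∈ I, δ ≤ v i) (m : ℝ) :
    δ / (4 * n) * ∑ i ∈ I, ∑ i' ∈ I, (y i - y i') ^ 2 ≤ ∑ i, v i * (y i - m) ^ 2 := by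
  have h1 : ∑ i ∈ I, ∑ i' ∈ I, (y i - y i') ^ 2 ≤ 4 * n * ∑ i ∈ I, (y i - m) ^ 2 := by
    calc ∑ i ∈ I, ∑ i' ∈ I, (y i - y i') ^ 2
        ≤ ∑ i ∈ I, ∑ i' ∈ I, (2 * (y i - m) ^ 2 + 2 * (y i' - m) ^ 2) :=
          Finset.sum_le_sum fun i _ => Finset.sum_le_sum fun i' _ => by
            nlinarith [sq_nonneg (y i - m + (y i' - m))]
      _ = 4 * I.card * ∑ i ∈ I, (y i - m) ^ 2 := by
          simp only [Finset.sum_add_distrib, Finset.sum_const, nsmul_eq_mul, ← Finset.mul_sum]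
          ring
      _ ≤ _ := by
          have : (I.card : ℝ) ≤ n := by exact_mod_cast (by simpa using I.card_le_univ)
          have h0 : 0 ≤ ∑ i ∈ I, (y i - m) ^ 2 := Finset.sum_nonneg fun _ _ => sq_nonneg _
          nlinarith
  have h2 : δ * ∑ i ∈ I, (y i - m) ^ 2 ≤ ∑ i, v i * (y i - m) ^ 2 := by
    rw [Finset.mul_sum]
    calc ∑ i ∈ I, δ * (y i - m) ^ 2 ≤ ∑ i ∈ I, v i * (y i - m) ^ 2 :=
          Finset.sum_le_sum fun i hi => mul_le_mul_of_nonneg_right (hvI i hi) (sq_nonneg _)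
      _ ≤ _ := Finset.sum_le_univ_sum_of_nonneg fun i => mul_nonneg (hv i) (sq_nonneg _)
  refine le_trans ?_ h2
  rcases Nat.eq_zero_or_pos n with rfl | hn
  · simp only [CharP.cast_eq_zero, mul_zero, div_zero, zero_mul]
    exact mul_nonneg hδ.le (Finset.sum_nonneg fun _ _ => sq_nonneg _)
  · have hn' : (0 : ℝ) < n := by exact_mod_cast hn
    calc δ / (4 * n) * ∑ i ∈ I, ∑ i' ∈ I, (y i - y i') ^ 2
        ≤ δ / (4 * n) * (4 * n * ∑ i ∈ I, (y i - m) ^ 2) :=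
          mul_le_mul_of_nonneg_left h1 (by positivity)
      _ = _ := by field_simp

theorem InGeneralPosition.isExpanding {ε : ℝ} {X : Sample n p q} {I : Finset (Fin n)}
    (h : InGeneralPosition ε X I) {v : Fin n → ℝ} {δ σ : ℝ} (hδ : 0 < δ)
    (hv : ∀ i, 0 ≤ v i) (hvI : ∀ i ∈ I, δ ≤ v i) (hs : 0 < ∑ i, v i) (hσ : ∑ i, v i ≤ σ)
    (M : Matrix (Fin p) (Fin q) ℝ)
    {S : Matrix (Fin p) (Fin p) ℝ} {T : Matrix (Fin q) (Fin q) ℝ} (hS : Sᵀ * S = 1)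
    (hT : Tᵀ * T = 1) :
    IsExpanding (σ⁻¹ * (δ / (4 * n)) * ε)
      fun j k => (∑ i, v i)⁻¹ * ∑ i, v i * (Sᵀ * (X i - M) * T) j k ^ 2 := by
  have hσ0 : 0 < σ := hs.trans_le hσ
  refine ((h S T hS hT).const_mul (t := σ⁻¹ * (δ / (4 * n))) (by positivity)).mono le_rfl ?_
  intro j k
  have h1 := sum_sum_sub_sq_le (y := fun i => (Sᵀ * X i * T) j k) hδ hv hvI ((Sᵀ * M * T) j k)
  simp only [Matrix.mul_sub, Matrix.sub_mul, Matrix.sub_apply]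
  rw [mul_assoc]
  refine mul_le_mul (inv_anti₀ hs hσ) h1 ?_ (inv_nonneg.2 hs.le)
  positivity

/-- The eigenvalue products of the two covariance matrices lie in `[exp (-C), exp C]`. -/
def SpectrumBounded (C : ℝ) (A : Matrix (Fin p) (Fin p) ℝ) (B : Matrix (Fin q) (Fin q) ℝ)
    (hA : A.PosDef) (hB : B.PosDef) : Prop :=
  ∀ j k, |(-Real.log (hA.isHermitian.eigenvalues j)) + -Real.log (hB.isHermitian.eigenvalues k)| ≤ C

/-- Bounded likelihood implies bounded spectrum, uniformly in the sample. -/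
theorem exists_spectrumBounded (hp : 0 < p) (hq : 0 < q) (hn : 0 < n) {ε δ σ : ℝ} (hε : 0 < ε)
    (hδ : 0 < δ) (hσ : 0 < σ) (C₀ : ℝ) :
    ∃ C : ℝ, ∀ (X : Sample n p q) (I : Finset (Fin n)) (v : Fin n → ℝ) (θ : Params p q),
      InGeneralPosition ε X I → (∀ i, 0 ≤ v i) → (∀ i ∈ I, δ ≤ v i) → 0 < ∑ i, v i →
      ∑ i, v i ≤ σ → likelihood X v θ ≤ C₀ →
      SpectrumBounded C θ.row θ.col θ.row_posDef θ.col_posDef := by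
  have hn' : (0 : ℝ) < n := by exact_mod_cast hn
  obtain ⟨C, hC⟩ := exists_bound_of_isExpanding hp hq
    (show 0 < σ⁻¹ * (δ / (4 * n)) * ε by positivity) C₀
  refine ⟨C, fun X I v θ hX hv hvI hs hsσ hL => ?_⟩
  obtain ⟨S, hS, hA⟩ := posDef_spectral θ.row_posDef
  obtain ⟨T, hT, hB⟩ := posDef_spectral θ.col_posDef
  refine hC (fun j => -Real.log (θ.row_posDef.isHermitian.eigenvalues j))
    (fun k => -Real.log (θ.col_posDef.isHermitian.eigenvalues k)) _ ?_
    (hX.isExpanding hδ hv hvI hs hsσ θ.loc hS hT) ?_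
  · intro j k
    exact mul_nonneg (inv_nonneg.2 hs.le)
      (Finset.sum_nonneg fun i _ => mul_nonneg (hv i) (sq_nonneg _))
  · have := spectralLikelihood_eq X v θ.loc hS hT
      (fun j => -Real.log (θ.row_posDef.isHermitian.eigenvalues j))
      (fun k => -Real.log (θ.col_posDef.isHermitian.eigenvalues k))
    rw [spectralMatrix, spectralMatrix, ← hA, ← hB] at this
    rw [likelihood, objective, ← this] at hL
    exact hL

/-- The shift is the rescaling (κ Σ^row, κ⁻¹ Σ^col): the sums a j + b k do not change, and the terms
pqt cancel. -/
theorem spectralLikelihood_shift (X : Sample n p q) (v : Fin n → ℝ) (M : Matrix (Fin p) (Fin q) ℝ)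
    (S : Matrix (Fin p) (Fin p) ℝ) (T : Matrix (Fin q) (Fin q) ℝ) (a : Fin p → ℝ) (b : Fin q → ℝ)
    (t : ℝ) :
    spectralLikelihood X v M (S, T, fun j => a j - t, fun k => b k + t) =
      spectralLikelihood X v M (S, T, a, b) := by
  simp only [spectralLikelihood, sub_add_add_cancel, Finset.sum_add_distrib,
    Finset.sum_sub_distrib, Finset.sum_const, Finset.card_univ, Fintype.card_fin, nsmul_eq_mul]
  ring

theorem isHermitian_scatter {B : Matrix (Fin q) (Fin q) ℝ} (hB : B.IsHermitian) (t : ℝ)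
    (v : Fin n → ℝ) (Z : Fin n → Matrix (Fin p) (Fin q) ℝ) :
    (t • ∑ i, v i • (Z i * B⁻¹ * (Z i)ᵀ)).IsHermitian := by
  have hB' : B⁻¹ᵀ = B⁻¹ := by
    have := hB.inv
    rwa [IsHermitian, conjTranspose_eq_transpose_of_trivial] at this
  rw [IsHermitian, conjTranspose_eq_transpose_of_trivial]
  simp only [transpose_smul, transpose_sum, transpose_mul, transpose_transpose, hB',
    Matrix.mul_assoc]

/-- Estimates exist as soon as the observations with weight contain some in general position. -/
theorem exists_isWeightedMLE (hp : 0 < p) (hq : 0 < q) {ε : ℝ} (hε : 0 < ε) {X : Sample n p q}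
    {I : Finset (Fin n)} (hX : InGeneralPosition ε X I) (hI : I.Nonempty) {v : Fin n → ℝ}
    (hv : ∀ i, 0 ≤ v i) (hvI : ∀ i ∈ I, 0 < v i) : ∃ θ, IsWeightedMLE X v θ := by
  obtain ⟨i₀, hi₀, hmin⟩ := I.exists_min_image v hI
  have hδ := hvI i₀ hi₀
  have hn : 0 < n := i₀.pos
  have hn' : (0 : ℝ) < n := by exact_mod_cast hn
  have hs : 0 < ∑ i, v i :=
    Finset.sum_pos' (fun i _ => hv i) ⟨i₀, Finset.mem_univ _, hδ⟩
  have hp' : (0 : ℝ) < p := by exact_mod_cast hp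
  have hq' : (0 : ℝ) < q := by exact_mod_cast hq
  set s := ∑ i, v i with hsdef
  set M := s⁻¹ • ∑ i, v i • X i with hM
  set J := spectralLikelihood X v M with hJ
  set C₀ := J (1, 1, fun _ => 0, fun _ => 0) with hC₀
  obtain ⟨C, hC⟩ := exists_bound_of_isExpanding hp hq
    (show 0 < s⁻¹ * (v i₀ / (4 * n)) * ε by positivity) C₀
  have hbound : ∀ S T a b, Sᵀ * S = 1 → Tᵀ * T = 1 → J (S, T, a, b) ≤ C₀ →
      ∀ j k, |a j + b k| ≤ C := fun S T a b hS hT hle =>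
    hC a b _ (fun j k => mul_nonneg (inv_nonneg.2 hs.le)
      (Finset.sum_nonneg fun i _ => mul_nonneg (hv i) (sq_nonneg _)))
      (hX.isExpanding hδ hv hmin hs le_rfl M hS hT) hle
  -- Coercivity bounds only the sums a j + b k. Once the rescaling is used to make the first a zero,
  -- |b k| ≤ C and |a j| ≤ 2C.
  set K : Set (Matrix (Fin p) (Fin p) ℝ × Matrix (Fin q) (Fin q) ℝ × (Fin p → ℝ) × (Fin q → ℝ)) :=
    {S | Sᵀ * S = 1} ×ˢ {T | Tᵀ * T = 1} ×ˢ {a | ∀ j, |a j| ≤ 2 * C} ×ˢ {b | ∀ k, |b k| ≤ C}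
    with hK
  have hKc : IsCompact K := (isCompact_orthogonal p).prod ((isCompact_orthogonal q).prod
    ((isCompact_vector_box p _).prod (isCompact_vector_box q _)))
  have hC0 : 0 ≤ C := by
    have := hbound 1 1 (fun _ => 0) (fun _ => 0) (by simp) (by simp) le_rfl ⟨0, hp⟩ ⟨0, hq⟩
    simpa using this
  have hK1 : ((1, 1, fun _ => 0, fun _ => 0) :
      Matrix (Fin p) (Fin p) ℝ × Matrix (Fin q) (Fin q) ℝ × (Fin p → ℝ) × (Fin q → ℝ)) ∈ K := by
    simp [hK, hC0]
  obtain ⟨⟨S, T, a, b⟩, hxK, hx⟩ := hKc.exists_isMinOn ⟨_, hK1⟩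
    (continuous_spectralLikelihood X v M).continuousOn
  have hS : Sᵀ * S = 1 := hxK.1
  have hT : Tᵀ * T = 1 := hxK.2.1
  -- Outside the sublevel set of C₀, the value at the identity, nothing can beat the minimum; inside
  -- it, every point can be shifted into `K`.
  have hglobal : ∀ S' T' a' b', S'ᵀ * S' = 1 → T'ᵀ * T' = 1 →
      J (S, T, a, b) ≤ J (S', T', a', b') := by
    intro S' T' a' b' hS' hT'
    rcases le_or_gt (J (S', T', a', b')) C₀ with hle | hgt
    · have hab := hbound S' T' a' b' hS' hT' hle
      rw [hJ, ← spectralLikelihood_shift X v M S' T' a' b' (a' ⟨0, hp⟩)]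
      apply hx
      refine ⟨hS', hT', fun j => ?_, fun k => ?_⟩
      · have h1 := abs_le.1 (hab j ⟨0, hq⟩)
        have h2 := abs_le.1 (hab ⟨0, hp⟩ ⟨0, hq⟩)
        exact abs_le.2 ⟨by linarith, by linarith⟩
      · have h1 := abs_le.1 (hab ⟨0, hp⟩ k)
        exact abs_le.2 ⟨by linarith, by linarith⟩
    · exact (hx hK1).trans hgt.le
  set A := spectralMatrix S a with hA
  set B := spectralMatrix T b with hB
  have hAp : A.PosDef := spectralMatrix_posDef hS a
  have hBp : B.PosDef := spectralMatrix_posDef hT b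
  have hmin' : ∀ A' B', A'.PosDef → B'.PosDef →
      s⁻¹ * ∑ i, v i * mahalanobisSq (X i - M) A B + (p * Real.log B.det + q * Real.log A.det) ≤
      s⁻¹ * ∑ i, v i * mahalanobisSq (X i - M) A' B' +
        (p * Real.log B'.det + q * Real.log A'.det) := by
    intro A' B' hA' hB'
    obtain ⟨S', hS', hA''⟩ := posDef_spectral hA'
    obtain ⟨T', hT', hB''⟩ := posDef_spectral hB'
    have h1 := hglobal S' T' (fun j => -Real.log (hA'.isHermitian.eigenvalues j))
      (fun k => -Real.log (hB'.isHermitian.eigenvalues k)) hS' hT'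
    rw [hJ, spectralLikelihood_eq X v M hS hT, spectralLikelihood_eq X v M hS' hT'] at h1
    rw [← spectralMatrix] at hA'' hB''
    rwa [← hA'', ← hB''] at h1
  refine ⟨⟨M, A, B, hAp, hBp⟩, hM, ?_, ?_⟩
  -- With the other covariance fixed, the likelihood divided by q is tr(A⁻¹ C) + log det A plus a
  -- constant, where C is the right side of the row equation.
  · refine eq_of_forall_trace_add_log_det_le hAp ?_ ?_
    · exact isHermitian_scatter hBp.isHermitian _ v fun i => X i - M
    · intro A' hA'
      have h1 := hmin' A' B hA' hBp
      have e : ∀ A'' : Matrix (Fin p) (Fin p) ℝ, trace (A''⁻¹ * ((q * s)⁻¹ •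
          ∑ i, v i • ((X i - M) * B⁻¹ * (X i - M)ᵀ))) =
          (q : ℝ)⁻¹ * (s⁻¹ * ∑ i, v i * mahalanobisSq (X i - M) A'' B) := by
        intro A''
        simp only [Matrix.mul_smul, Matrix.mul_sum, trace_smul, trace_sum, smul_eq_mul]
        rw [mul_inv, mul_assoc]
        congr 2
        refine Finset.sum_congr rfl fun i _ => ?_
        rw [mahalanobisSq, Matrix.mul_assoc _ A''⁻¹, trace_mul_comm (B⁻¹ * _)]
        simp only [Matrix.mul_assoc]
      rw [e, e]
      have h2 := mul_le_mul_of_nonneg_left h1 (inv_nonneg.2 hq'.le)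
      simp only [mul_add, inv_mul_cancel_left₀ hq'.ne'] at h2
      linarith
  · refine eq_of_forall_trace_add_log_det_le hBp ?_ ?_
    · simpa only [transpose_transpose] using
        isHermitian_scatter hAp.isHermitian (p * s)⁻¹ v fun i => (X i - M)ᵀ
    · intro B' hB'
      have h1 := hmin' A B' hAp hB'
      have e : ∀ B'' : Matrix (Fin q) (Fin q) ℝ, trace (B''⁻¹ * ((p * s)⁻¹ •
          ∑ i, v i • ((X i - M)ᵀ * A⁻¹ * (X i - M)))) =
          (p : ℝ)⁻¹ * (s⁻¹ * ∑ i, v i * mahalanobisSq (X i - M) A B'') := by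
        intro B''
        simp only [Matrix.mul_smul, Matrix.mul_sum, trace_smul, trace_sum, smul_eq_mul]
        rw [mul_inv, mul_assoc]
        congr 2
        refine Finset.sum_congr rfl fun i _ => ?_
        rw [mahalanobisSq]
        simp only [Matrix.mul_assoc]
      rw [e, e]
      have h2 := mul_le_mul_of_nonneg_left h1 (inv_nonneg.2 hp'.le)
      simp only [mul_add, inv_mul_cancel_left₀ hp'.ne'] at h2
      linarith

end Existence

/-! ### Charts for tuples of matrices with a common vanishing block -/

section Genericity

variable {n p q : ℕ}

theorem pi_absolutelyContinuous {E : Type*} [MeasurableSpace E] :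
    ∀ (n : ℕ) (μ ν : Fin n → Measure E) [∀ i, SigmaFinite (μ i)] [∀ i, SigmaFinite (ν i)],
      (∀ i, μ i ≪ ν i) → Measure.pi μ ≪ Measure.pi ν := by
  intro n
  induction n with
  | zero =>
    intro μ ν _ _ _
    rw [Measure.pi_of_empty μ, Measure.pi_of_empty ν]
  | succ n ih =>
    intro μ ν _ _ h
    have h1 := (measurePreserving_piFinSuccAbove μ 0).symm
    have h2 := (measurePreserving_piFinSuccAbove ν 0).symm
    rw [← h1.map_eq, ← h2.map_eq]
    exact ((h 0).prod (ih _ _ fun i => h _)).map (MeasurableEquiv.measurable _)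

/-- Extension by zero of a function on a subtype. -/
def extendZero {α : Type*} (P : α → Prop) [DecidablePred P] (f : {x // P x} → ℝ) (x : α) : ℝ :=
  if h : P x then f ⟨x, h⟩ else 0

theorem contDiff_extendZero {α : Type*} [Fintype α] (P : α → Prop) [DecidablePred P] (x : α) :
    ContDiff ℝ 1 (fun f : {x // P x} → ℝ => extendZero P f x) := by
  unfold extendZero
  split_ifs with h
  · exact contDiff_apply ℝ ℝ _
  · exact contDiff_const

/-- The chart whose range contains all `r`-tuples of `p × q` matrices that have a vanishing block
after unipotent row and column operations indexed by `J` and `K`. -/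
def blockChart (r : ℕ) (J : Finset (Fin p)) (K : Finset (Fin q))
    (x : ({x : Fin p × Fin p // x.1 ∈ J ∧ x.2 ∉ J} → ℝ) ×
      ({x : Fin q × Fin q // x.1 ∉ K ∧ x.2 ∈ K} → ℝ) ×
      ({x : Fin r × Fin p × Fin q // ¬ (x.2.1 ∈ J ∧ x.2.2 ∈ K)} → ℝ))
    (y : Fin r × Fin p × Fin q) : ℝ :=
  extendZero _ x.2.2 y -
    if y.2.1 ∈ J ∧ y.2.2 ∈ K then
      ∑ l, ∑ m, ((if y.2.1 = l then 1 else 0) + extendZero _ x.1 (y.2.1, l)) *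
        extendZero _ x.2.2 (y.1, l, m) *
        ((if m = y.2.2 then 1 else 0) + extendZero _ x.2.1 (m, y.2.2))
    else 0

theorem contDiff_blockChart (r : ℕ) (J : Finset (Fin p)) (K : Finset (Fin q)) :
    ContDiff ℝ 1 (blockChart r J K) := by
  rw [contDiff_pi]
  intro y
  unfold blockChart
  refine ((contDiff_extendZero _ y).comp (contDiff_snd.comp contDiff_snd)).sub ?_
  split_ifs with h
  · refine ContDiff.sum fun l _ => ContDiff.sum fun m _ => ?_
    refine ((contDiff_const.add ?_).mul ?_).mul (contDiff_const.add ?_)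
    · exact (contDiff_extendZero _ _).comp contDiff_fst
    · exact (contDiff_extendZero _ _).comp (contDiff_snd.comp contDiff_snd)
    · exact (contDiff_extendZero _ _).comp (contDiff_fst.comp contDiff_snd)
  · exact contDiff_const

/-- A C¹ image has Hausdorff dimension at most the number of parameters. The hypothesis says that
this is less than r p q, so the image is Lebesgue null. -/
theorem volume_range_blockChart {r : ℕ} (J : Finset (Fin p)) (K : Finset (Fin q))
    (h : J.card * (p - J.card) + K.card * (q - K.card) < r * (J.card * K.card)) :
    volume (Set.range (blockChart r J K)) = 0 := by
  have hJ : J.card ≤ p := by simpa using J.card_le_univ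
  have hK : K.card ≤ q := by simpa using K.card_le_univ
  have c1 : Fintype.card {x : Fin p × Fin p // x.1 ∈ J ∧ x.2 ∉ J} = J.card * (p - J.card) := by
    rw [Fintype.card_subtype]
    have : (Finset.univ.filter fun x : Fin p × Fin p => x.1 ∈ J ∧ x.2 ∉ J) = J ×ˢ Jᶜ := by
      ext x; simp
    rw [this, Finset.card_product, Finset.card_compl, Fintype.card_fin]
  have c2 : Fintype.card {x : Fin q × Fin q // x.1 ∉ K ∧ x.2 ∈ K} = K.card * (q - K.card) := by
    rw [Fintype.card_subtype]
    have : (Finset.univ.filter fun x : Fin q × Fin q => x.1 ∉ K ∧ x.2 ∈ K) = Kᶜ ×ˢ K := by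
      ext x; simp
    rw [this, Finset.card_product, Finset.card_compl, Fintype.card_fin, mul_comm]
  have c3 : Fintype.card {x : Fin r × Fin p × Fin q // ¬ (x.2.1 ∈ J ∧ x.2.2 ∈ K)} =
      r * (p * q) - r * (J.card * K.card) := by
    rw [Fintype.card_subtype]
    have : (Finset.univ.filter fun x : Fin r × Fin p × Fin q => ¬ (x.2.1 ∈ J ∧ x.2.2 ∈ K)) =
        (Finset.univ ×ˢ (J ×ˢ K))ᶜ := by
      ext x; simp
    rw [this, Finset.card_compl, Finset.card_product, Finset.card_product]
    simp
  have hle : r * (J.card * K.card) ≤ r * (p * q) :=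
    Nat.mul_le_mul_left _ (Nat.mul_le_mul hJ hK)
  have hdim := (contDiff_blockChart r J K).dimH_range_le
  rw [Module.finrank_prod, Module.finrank_prod, Module.finrank_fintype_fun_eq_card,
    Module.finrank_fintype_fun_eq_card, Module.finrank_fintype_fun_eq_card, c1, c2, c3] at hdim
  have hlt : dimH (Set.range (blockChart r J K)) <
      ((Fintype.card (Fin r × Fin p × Fin q) : NNReal) : ℝ≥0∞) := by
    refine hdim.trans_lt ?_
    have : J.card * (p - J.card) + (K.card * (q - K.card) +
        (r * (p * q) - r * (J.card * K.card))) < Fintype.card (Fin r × Fin p × Fin q) := by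
      simp only [Fintype.card_prod, Fintype.card_fin]
      omega
    exact_mod_cast this
  have := hausdorffMeasure_of_dimH_lt hlt
  rw [← hausdorffMeasure_pi_real]
  exact_mod_cast this

/-- The transformations restrict to the identity on J and on K, so the (j,k) entry of the vanishing
block is Z i j k plus a function of the entries outside J × K. The equations can therefore be solved
for the entries inside the block. -/
theorem mem_range_blockChart {r : ℕ} {J : Finset (Fin p)} {K : Finset (Fin q)}
    (Z : Fin r × Fin p × Fin q → ℝ) (F : Fin p → Fin p → ℝ) (E : Fin q → Fin q → ℝ)
    (hF : ∀ j ∈ J, ∀ l ∈ J, F j l = if j = l then 1 else 0)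
    (hE : ∀ k ∈ K, ∀ m ∈ K, E m k = if m = k then 1 else 0)
    (h : ∀ i, ∀ j ∈ J, ∀ k ∈ K, ∑ l, ∑ m, F j l * Z (i, l, m) * E m k = 0) :
    Z ∈ Set.range (blockChart r J K) := by
  refine ⟨(fun x => F x.1.1 x.1.2, fun x => E x.1.1 x.1.2, fun x => Z x.1), ?_⟩
  ext ⟨i, j, k⟩
  simp only [blockChart]
  by_cases hjk : j ∈ J ∧ k ∈ K
  · obtain ⟨hj, hk⟩ := hjk
    have eF : ∀ l, (if j = l then 1 else 0) + extendZero (fun x : Fin p × Fin p => x.1 ∈ J ∧ x.2 ∉ J)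
        (fun x => F x.1.1 x.1.2) (j, l) = F j l := by
      intro l
      by_cases hl : l ∈ J
      · simp [extendZero, hl, hF j hj l hl]
      · have : j ≠ l := fun e => hl (e ▸ hj)
        simp [extendZero, hl, hj, this]
    have eE : ∀ m, (if m = k then 1 else 0) + extendZero (fun x : Fin q × Fin q => x.1 ∉ K ∧ x.2 ∈ K)
        (fun x => E x.1.1 x.1.2) (m, k) = E m k := by
      intro m
      by_cases hm : m ∈ K
      · simp [extendZero, hm, hE k hk m hm]
      · have : m ≠ k := fun e => hm (e ▸ hk)
        simp [extendZero, hm, hk, this]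
    rw [if_pos ⟨hj, hk⟩]
    simp only [eF, eE]
    have e0 : extendZero (fun x : Fin r × Fin p × Fin q => ¬ (x.2.1 ∈ J ∧ x.2.2 ∈ K))
        (fun x => Z x.1) (i, j, k) = 0 := by simp [extendZero, hj, hk]
    have e1 : ∀ l m, extendZero (fun x : Fin r × Fin p × Fin q => ¬ (x.2.1 ∈ J ∧ x.2.2 ∈ K))
        (fun x => Z x.1) (i, l, m) = Z (i, l, m) - if l ∈ J ∧ m ∈ K then Z (i, l, m) else 0 := by
      intro l m
      by_cases hlm : l ∈ J ∧ m ∈ K <;> simp [extendZero, hlm]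
    have e2 : ∑ l, ∑ m, F j l * (if l ∈ J ∧ m ∈ K then Z (i, l, m) else 0) * E m k =
        Z (i, j, k) := by
      rw [Finset.sum_eq_single j, Finset.sum_eq_single k]
      · simp [hF j hj j hj, hE k hk k hk, hj, hk]
      · intro m _ hm
        by_cases hmK : m ∈ K
        · simp [hE k hk m hmK, hm]
        · simp [hmK]
      · simp
      · intro l _ hl
        refine Finset.sum_eq_zero fun m _ => ?_
        by_cases hlJ : l ∈ J
        · simp [hF j hj l hlJ, hl.symm]
        · simp [hlJ]
      · simp
    rw [e0]
    simp only [e1, mul_sub, sub_mul, Finset.sum_sub_distrib]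
    rw [h i j hj k hk, e2]
    ring
  · rw [if_neg hjk, sub_zero]
    simp [extendZero, hjk]

/-- A subspace of `ℝ^p` has a basis in reduced form with respect to some set of coordinates. -/
theorem exists_reduced_basis (W : Submodule ℝ (Fin p → ℝ)) :
    ∃ J : Finset (Fin p), J.card = Module.finrank ℝ W ∧
      ∀ j ∈ J, ∃ u ∈ W, ∀ l ∈ J, u l = if j = l then 1 else 0 := by
  classical
  set φ : Fin p → Module.Dual ℝ W := fun l => (LinearMap.proj l).comp W.subtype with hφ
  obtain ⟨κ, a, ha, hspan, hli⟩ := exists_linearIndependent' ℝ φ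
  have : Finite κ := Finite.of_injective a ha
  have := Fintype.ofFinite κ
  set Ψ : W →ₗ[ℝ] (κ → ℝ) := LinearMap.pi fun c => φ (a c) with hΨ
  -- The selected coordinate functionals are independent on W and span all coordinates, so a vector
  -- of W on which they vanish is zero; counting dimensions makes `Ψ` bijective.
  have hinj : Function.Injective Ψ := by
    rw [← LinearMap.ker_eq_bot, LinearMap.ker_eq_bot']
    intro x hx
    have h1 : ∀ c, φ (a c) x = 0 := fun c => congrFun hx c
    have h2 : Submodule.span ℝ (Set.range φ) ≤ LinearMap.ker (Module.Dual.eval ℝ W x) := by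
      rw [← hspan, Submodule.span_le]
      rintro _ ⟨c, rfl⟩
      exact h1 c
    ext l
    exact h2 (Submodule.subset_span ⟨l, rfl⟩)
  have hc1 : Fintype.card κ ≤ Module.finrank ℝ W := by
    have := hli.fintype_card_le_finrank
    rwa [Subspace.dual_finrank_eq] at this
  have hc2 : Module.finrank ℝ W ≤ Fintype.card κ := by
    have := LinearMap.finrank_le_finrank_of_injective hinj
    rwa [Module.finrank_fintype_fun_eq_card] at this
  have hsurj : Function.Surjective Ψ :=
    (LinearMap.injective_iff_surjective_of_finrank_eq_finrank (by
      rw [Module.finrank_fintype_fun_eq_card]; omega)).1 hinj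
  refine ⟨Finset.univ.image a, ?_, ?_⟩
  · rw [Finset.card_image_of_injective _ ha, Finset.card_univ]
    omega
  · intro j hj
    obtain ⟨c, -, rfl⟩ := Finset.mem_image.1 hj
    obtain ⟨u, hu⟩ := hsurj (Pi.single c 1)
    refine ⟨u, u.2, fun l hl => ?_⟩
    obtain ⟨c', -, rfl⟩ := Finset.mem_image.1 hl
    have : (u : Fin p → ℝ) (a c') = Ψ u c' := rfl
    rw [this, hu, Pi.single_apply]
    simp [ha.eq_iff, eq_comm]

end Genericity

/-! ### Almost sure general position -/

section Genericity

variable {n p q : ℕ}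

/-- Vanishing of a block depends only on the two subspaces, so the orthogonal columns may be
exchanged for reduced bases. -/
theorem bilinear_eq_zero_of_mem_span {ι κ : Type*} {Z : Matrix (Fin p) (Fin q) ℝ}
    {f : ι → Fin p → ℝ} {g : κ → Fin q → ℝ} (h : ∀ i k, f i ⬝ᵥ (Z *ᵥ g k) = 0)
    {u : Fin p → ℝ} {t : Fin q → ℝ} (hu : u ∈ Submodule.span ℝ (Set.range f))
    (ht : t ∈ Submodule.span ℝ (Set.range g)) : u ⬝ᵥ (Z *ᵥ t) = 0 := by
  induction hu using Submodule.span_induction with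
  | mem x hx =>
    obtain ⟨i, rfl⟩ := hx
    induction ht using Submodule.span_induction with
    | mem y hy => obtain ⟨k, rfl⟩ := hy; exact h i k
    | zero => simp
    | add x y _ _ hx hy => rw [mulVec_add, dotProduct_add, hx, hy, add_zero]
    | smul a x _ hx => rw [mulVec_smul, dotProduct_smul, hx, smul_zero]
  | zero => simp
  | add x y _ _ hx hy => rw [add_dotProduct, hx, hy, add_zero]
  | smul a x _ hx => rw [smul_dotProduct, hx, smul_zero]

theorem finrank_span_columns {S : Matrix (Fin p) (Fin p) ℝ} (hS : IsUnit S) (J : Finset (Fin p)) :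
    Module.finrank ℝ (Submodule.span ℝ (Set.range fun j : J => fun l => S l j)) = J.card := by
  have h1 : LinearIndependent ℝ (fun j l => S l j) := Matrix.linearIndependent_cols_of_isUnit hS
  have h2 : LinearIndependent ℝ (fun j : J => fun l => S l j) := h1.comp _ Subtype.val_injective
  rw [finrank_span_eq_card h2, Fintype.card_coe]

/-- Reduced bases of the column spans of S and T put the tuple into a chart. The index sets may
change but their sizes do not, so finitely many charts cover all choices of S and T. -/
theorem exists_mem_range_blockChart {r : ℕ} (Z : Fin r → Matrix (Fin p) (Fin q) ℝ)
    {S : Matrix (Fin p) (Fin p) ℝ} {T : Matrix (Fin q) (Fin q) ℝ} (hS : IsUnit S) (hT : IsUnit T)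
    {J : Finset (Fin p)} {K : Finset (Fin q)}
    (h : ∀ i, ∀ j ∈ J, ∀ k ∈ K, (Sᵀ * Z i * T) j k = 0) :
    ∃ (J' : Finset (Fin p)) (K' : Finset (Fin q)), J'.card = J.card ∧ K'.card = K.card ∧
      (fun y : Fin r × Fin p × Fin q => Z y.1 y.2.1 y.2.2) ∈ Set.range (blockChart r J' K') := by
  classical
  obtain ⟨J', hJ', hu⟩ :=
    exists_reduced_basis (Submodule.span ℝ (Set.range fun j : J => fun l => S l j))
  obtain ⟨K', hK', ht⟩ :=
    exists_reduced_basis (Submodule.span ℝ (Set.range fun k : K => fun l => T l k))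
  rw [finrank_span_columns hS] at hJ'
  rw [finrank_span_columns hT] at hK'
  choose! u huW hu using hu
  choose! t htW ht using ht
  refine ⟨J', K', hJ', hK', mem_range_blockChart _ u (fun m k => t k m) hu ?_ ?_⟩
  · intro k hk m hm
    rw [ht k hk m hm]
    simp [eq_comm]
  · intro i j hj k hk
    have h1 := bilinear_eq_zero_of_mem_span (Z := Z i) ?_ (huW j hj) (htW k hk)
    · rw [← h1]
      simp only [dotProduct, mulVec, Finset.mul_sum, mul_assoc]
    · intro j k
      have := h i j j.2 k k.2
      rw [← this]
      simp only [dotProduct, mulVec, mul_apply, transpose_apply, Finset.mul_sum, Finset.sum_mul]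
      rw [Finset.sum_comm]
      exact Finset.sum_congr rfl fun _ _ => Finset.sum_congr rfl fun _ _ => by ring

/-- Differences of observations with respect to the first one, in flat coordinates. -/
def differences (r : ℕ) (e : Fin (r + 1) ↪ Fin n) :
    (Fin n → Fin p → Fin q → ℝ) →ₗ[ℝ] (Fin r × Fin p × Fin q → ℝ) where
  toFun Y y := Y (e y.1.succ) y.2.1 y.2.2 - Y (e 0) y.2.1 y.2.2
  map_add' Y Y' := by ext y; simp only [Pi.add_apply]; ring
  map_smul' a Y := by ext y; simp only [Pi.smul_apply, smul_eq_mul, RingHom.id_apply]; ring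

theorem differences_surjective (r : ℕ) (e : Fin (r + 1) ↪ Fin n) :
    Function.Surjective (differences (p := p) (q := q) r e) := by
  intro z
  have hinj : Function.Injective fun i : Fin r => e i.succ :=
    e.injective.comp (Fin.succ_injective r)
  refine ⟨Function.extend (fun i : Fin r => e i.succ) (fun i j k => z (i, j, k)) 0, ?_⟩
  ext ⟨i, j, k⟩
  have h0 : ¬ ∃ i : Fin r, e i.succ = e 0 := by
    rintro ⟨i, hi⟩
    exact Fin.succ_ne_zero i (e.injective hi)
  simp only [differences, LinearMap.coe_mk, AddHom.coe_mk]
  rw [hinj.extend_apply, Function.extend_apply' _ _ _ h0]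
  simp

/-- A surjective linear map pushes Lebesgue measure to a (possibly infinite) multiple of Lebesgue
measure, so preimages of null sets are null; there are finitely many choices of e, J, K. -/
theorem ae_notMem_range_blockChart (n p q r : ℕ) :
    ∀ᵐ Y ∂(volume : Measure (Fin n → Fin p → Fin q → ℝ)), ∀ (e : Fin (r + 1) ↪ Fin n)
      (J : Finset (Fin p)) (K : Finset (Fin q)),
      J.card * (p - J.card) + K.card * (q - K.card) < r * (J.card * K.card) →
      differences r e Y ∉ Set.range (blockChart r J K) := by
  simp only [ae_all_iff]
  intro e J K h
  have h1 : (volume : Measure (Fin p → Fin q → ℝ)).IsAddHaarMeasure :=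
    Measure.pi.isAddHaarMeasure fun _ : Fin p => (volume : Measure (Fin q → ℝ))
  have h2 : (volume : Measure (Fin n → Fin p → Fin q → ℝ)).IsAddHaarMeasure :=
    Measure.pi.isAddHaarMeasure fun _ : Fin n => (volume : Measure (Fin p → Fin q → ℝ))
  obtain ⟨c, -, hc⟩ := (differences (p := p) (q := q) r e).exists_map_addHaar_eq_smul_addHaar
    volume volume (differences_surjective r e)
  have hmeas : AEMeasurable (differences (p := p) (q := q) r e) volume :=
    (LinearMap.continuous_of_finiteDimensional _).aemeasurable
  refine ae_of_ae_map (p := fun z => z ∉ Set.range (blockChart r J K)) hmeas ?_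
  rw [hc]
  refine Measure.ae_smul_measure ?_ c
  exact measure_eq_zero_iff_ae_notMem.1 (volume_range_blockChart J K h)

/-- The dimension count. -/
theorem dimension_count {r w v : ℕ} (hp : 0 < p) (hq : 0 < q) (hr : p ^ 2 + q ^ 2 < r * (p * q))
    (hw : 0 < w) (hv : 0 < v) (hwp : w ≤ p) (hvq : v ≤ q) (h : p * q ≤ q * w + p * v) :
    w * (p - w) + v * (q - v) < r * (w * v) := by
  obtain ⟨w', hw'⟩ := Nat.exists_eq_add_of_le hwp
  obtain ⟨v', hv'⟩ := Nat.exists_eq_add_of_le hvq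
  have e1 : p - w = w' := by omega
  have e2 : q - v = v' := by omega
  rw [e1, e2]
  have hpq : 0 < p * q := by positivity
  -- After multiplication by pq it suffices to prove pq (w w' + v v') ≤ (p² + q²) w v, where w' = p
  -- - w and v' = q - v.
  refine lt_of_mul_lt_mul_left (a := p * q) ?_ (Nat.zero_le _)
  have h1 : (p ^ 2 + q ^ 2) * (w * v) < p * q * (r * (w * v)) := by
    calc (p ^ 2 + q ^ 2) * (w * v) < r * (p * q) * (w * v) :=
          Nat.mul_lt_mul_of_pos_right hr (by positivity)
      _ = _ := by ring
  refine lt_of_le_of_lt ?_ h1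
  have hz : (p : ℤ) = w + w' := by exact_mod_cast hw'
  have hz' : (q : ℤ) = v + v' := by exact_mod_cast hv'
  have hh : (p : ℤ) * q ≤ q * w + p * v := by exact_mod_cast h
  -- The difference factors, and the second factor is nonnegative exactly when pq ≤ q w + p v.
  have key : ((p : ℤ) ^ 2 + q ^ 2) * (w * v) - p * q * (w * w' + v * v') =
      (w * p + v * q) * (p * v + q * w - p * q) := by
    rw [hz, hz']; ring
  have : (0 : ℤ) ≤ (w * p + v * q) * (p * v + q * w - p * q) :=
    mul_nonneg (by positivity) (by linarith)
  have h3 : (p : ℤ) * q * (w * w' + v * v') ≤ (p ^ 2 + q ^ 2) * (w * v) := by linarith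
  exact_mod_cast h3

/-- This is where d enters: d + 1 exceeds p/q + q/p; clear denominators. -/
theorem dimRatio_count (hp : 0 < p) (hq : 0 < q) :
    p ^ 2 + q ^ 2 < (dimRatio p q + 1) * (p * q) := by
  have h := Nat.lt_floor_add_one ((p : ℚ) / q + (q : ℚ) / p)
  have hp' : (0 : ℚ) < p := by exact_mod_cast hp
  have hq' : (0 : ℚ) < q := by exact_mod_cast hq
  have h2 : ((p : ℚ) / q + (q : ℚ) / p) * (p * q) < (dimRatio p q + 1) * (p * q) :=
    mul_lt_mul_of_pos_right h (by positivity)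
  have h3 : ((p : ℚ) / q + (q : ℚ) / p) * (p * q) = p ^ 2 + q ^ 2 := by field_simp
  rw [h3] at h2
  exact_mod_cast h2

theorem exists_pos_forall_le {α : Type*} [Finite α] {f : α → ℝ} (hf : ∀ a, 0 < f a) :
    ∃ ε : ℝ, 0 < ε ∧ ∀ a, ε ≤ f a := by
  cases nonempty_fintype α
  rcases isEmpty_or_nonempty α with h | h
  · exact ⟨1, one_pos, fun a => h.elim a⟩
  · obtain ⟨a, -, ha⟩ := Finset.exists_min_image Finset.univ f Finset.univ_nonempty
    exact ⟨f a, hf a, fun b => ha b (Finset.mem_univ b)⟩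

/-- Compactness of the orthogonal groups makes general position quantitative. -/
theorem exists_inGeneralPosition {X : Sample n p q} {I : Finset (Fin n)}
    (h : ∀ (S : Matrix (Fin p) (Fin p) ℝ) (T : Matrix (Fin q) (Fin q) ℝ), Sᵀ * S = 1 → Tᵀ * T = 1 →
      ∀ (J : Finset (Fin p)) (K : Finset (Fin q)), J.Nonempty → K.Nonempty →
        p * q ≤ q * J.card + p * K.card →
        ∃ i ∈ I, ∃ i' ∈ I, ∃ j ∈ J, ∃ k ∈ K, (Sᵀ * (X i - X i') * T) j k ≠ 0) :
    ∃ ε : ℝ, 0 < ε ∧ InGeneralPosition ε X I := by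
  set c : Matrix (Fin p) (Fin p) ℝ × Matrix (Fin q) (Fin q) ℝ → Fin p → Fin q → ℝ :=
    fun x j k => ∑ i ∈ I, ∑ i' ∈ I, (x.1ᵀ * (X i - X i') * x.2) j k ^ 2 with hc
  have hc0 : ∀ x j k, 0 ≤ c x j k := fun x j k =>
    Finset.sum_nonneg fun _ _ => Finset.sum_nonneg fun _ _ => sq_nonneg _
  set O : Set (Matrix (Fin p) (Fin p) ℝ × Matrix (Fin q) (Fin q) ℝ) :=
    {S | Sᵀ * S = 1} ×ˢ {T | Tᵀ * T = 1} with hO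
  have hOc : IsCompact O := (isCompact_orthogonal p).prod (isCompact_orthogonal q)
  have hOn : O.Nonempty := ⟨(1, 1), by simp [hO]⟩
  have key : ∀ JK : Finset (Fin p) × Finset (Fin q), ∃ η : ℝ, 0 < η ∧
      (JK.1.Nonempty → JK.2.Nonempty → p * q ≤ q * JK.1.card + p * JK.2.card →
        ∀ x ∈ O, ∃ j ∈ JK.1, ∃ k ∈ JK.2, η ≤ c x j k) := by
    rintro ⟨J, K⟩
    by_cases hJK : J.Nonempty ∧ K.Nonempty ∧ p * q ≤ q * J.card + p * K.card
    · obtain ⟨hJ, hK, hle⟩ := hJK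
      have hcont : Continuous fun x => ∑ j ∈ J, ∑ k ∈ K, c x j k := by
        simp only [hc]
        fun_prop
      obtain ⟨x₀, hx₀, hmin⟩ := hOc.exists_isMinOn hOn hcont.continuousOn
      have hpos : 0 < ∑ j ∈ J, ∑ k ∈ K, c x₀ j k := by
        obtain ⟨i, hi, i', hi', j, hj, k, hk, hne⟩ := h x₀.1 x₀.2 hx₀.1 hx₀.2 J K hJ hK hle
        refine Finset.sum_pos' (fun j _ => Finset.sum_nonneg fun k _ => hc0 _ _ _)
          ⟨j, hj, Finset.sum_pos' (fun k _ => hc0 _ _ _) ⟨k, hk, ?_⟩⟩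
        exact Finset.sum_pos' (fun _ _ => Finset.sum_nonneg fun _ _ => sq_nonneg _)
          ⟨i, hi, Finset.sum_pos' (fun _ _ => sq_nonneg _) ⟨i', hi', by positivity⟩⟩
      have hcard : (0 : ℝ) < J.card * K.card := by
        have := hJ.card_pos
        have := hK.card_pos
        positivity
      -- Some entry of the block is at least the average, and the block sum is at least its minimum
      -- over the compact set.
      refine ⟨(∑ j ∈ J, ∑ k ∈ K, c x₀ j k) / (J.card * K.card), by positivity, ?_⟩
      intro _ _ _ x hx
      by_contra! hlt
      have h1 : ∑ j ∈ J, ∑ k ∈ K, c x j k <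
          ∑ j ∈ J, ∑ k ∈ K, (∑ j ∈ J, ∑ k ∈ K, c x₀ j k) / (J.card * K.card) :=
        Finset.sum_lt_sum_of_nonempty hJ fun j hj =>
          Finset.sum_lt_sum_of_nonempty hK fun k hk => hlt j hj k hk
      have h2 : ∑ j ∈ J, ∑ k ∈ K, c x₀ j k ≤ ∑ j ∈ J, ∑ k ∈ K, c x j k := hmin hx
      rw [Finset.sum_const, Finset.sum_const, nsmul_eq_mul, nsmul_eq_mul, ← mul_assoc,
        mul_div_cancel₀ _ hcard.ne'] at h1
      linarith
    · exact ⟨1, one_pos, fun h1 h2 h3 => absurd ⟨h1, h2, h3⟩ hJK⟩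
  choose η hη0 hη using key
  obtain ⟨ε, hε, hεη⟩ := exists_pos_forall_le hη0
  refine ⟨ε, hε, fun S T hS hT J K hJ hK hle => ?_⟩
  obtain ⟨j, hj, k, hk, hjk⟩ := hη (J, K) hJ hK hle (S, T) ⟨hS, hT⟩
  exact ⟨j, hj, k, hk, (hεη _).trans hjk⟩

/-- A sample all of whose subsamples of size `d + 2` are in `ε`-general position. -/
def IsGeneric (ε : ℝ) (X : Sample n p q) : Prop :=
  ∀ I : Finset (Fin n), I.card = dimRatio p q + 2 → InGeneralPosition ε X I

/-- A block that vanishes for all pairs in I vanishes for the d + 1 differences to the first element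
of I, which places them in one of the excluded charts. There are finitely many I, so one ε serves
all. -/
theorem exists_isGeneric (hp : 0 < p) (hq : 0 < q) {X : Sample n p q}
    (h : ∀ (e : Fin (dimRatio p q + 1 + 1) ↪ Fin n) (J : Finset (Fin p)) (K : Finset (Fin q)),
      J.card * (p - J.card) + K.card * (q - K.card) < (dimRatio p q + 1) * (J.card * K.card) →
      differences (dimRatio p q + 1) e X ∉ Set.range (blockChart (dimRatio p q + 1) J K)) :
    ∃ ε : ℝ, 0 < ε ∧ IsGeneric ε X := by
  have key : ∀ I : Finset (Fin n), ∃ ε : ℝ, 0 < ε ∧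
      (I.card = dimRatio p q + 2 → InGeneralPosition ε X I) := by
    intro I
    by_cases hI : I.card = dimRatio p q + 2
    · suffices ∃ ε : ℝ, 0 < ε ∧ InGeneralPosition ε X I by
        obtain ⟨ε, hε, hX⟩ := this
        exact ⟨ε, hε, fun _ => hX⟩
      refine exists_inGeneralPosition fun S T hS hT J K hJ hK hle => ?_
      by_contra! hzero
      set e : Fin (dimRatio p q + 1 + 1) ↪ Fin n := (I.orderEmbOfFin hI).toEmbedding with he
      have heI : ∀ i, e i ∈ I := fun i => I.orderEmbOfFin_mem hI i
      obtain ⟨J', K', hJ', hK', hmem⟩ := exists_mem_range_blockChart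
        (fun i : Fin (dimRatio p q + 1) => X (e i.succ) - X (e 0)) (isUnit_of_orthogonal hS)
        (isUnit_of_orthogonal hT) (J := J) (K := K)
        fun i j hj k hk => hzero _ (heI _) _ (heI _) j hj k hk
      refine h e J' K' ?_ hmem
      rw [hJ', hK']
      exact dimension_count hp hq (dimRatio_count hp hq) hJ.card_pos hK.card_pos
        (by simpa using J.card_le_univ) (by simpa using K.card_le_univ) hle
    · exact ⟨1, one_pos, fun h => absurd h hI⟩
  choose η hη0 hη using key
  obtain ⟨ε, hε, hεη⟩ := exists_pos_forall_le hη0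
  refine ⟨ε, hε, fun I hI S T hS hT => ?_⟩
  exact (hη I hI S T hS hT).mono (hεη I) fun _ _ => le_rfl

/-- I.i.d. samples from an absolutely continuous distribution are almost surely generic. -/
theorem ae_exists_isGeneric {Ω : Type*} [MeasurableSpace Ω] (P : Measure Ω)
    [IsProbabilityMeasure P] (hp : 0 < p) (hq : 0 < q)
    (X : Fin n → Ω → Matrix (Fin p) (Fin q) ℝ) (hindep : iIndepFun X P)
    (hmeas : ∀ i, AEMeasurable (X i) P) (hcont : ∀ i, P.map (X i) ≪ lebesgue p q) :
    ∀ᵐ ω ∂P, ∃ ε : ℝ, 0 < ε ∧ IsGeneric ε fun i => X i ω := by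
  have h1 := (iIndepFun_iff_map_fun_eq_pi_map hmeas).1 hindep
  have hprob : ∀ i, IsProbabilityMeasure (P.map (X i)) := fun i =>
    Measure.isProbabilityMeasure_map (hmeas i)
  have hsf : SigmaFinite (lebesgue p q) :=
    inferInstanceAs (SigmaFinite (volume : Measure (Fin p → Fin q → ℝ)))
  have h2 : P.map (fun ω i => X i ω) ≪ Measure.pi fun _ : Fin n => lebesgue p q := by
    rw [h1]
    exact pi_absolutelyContinuous n _ _ hcont
  have h3 := ae_of_ae_map (aemeasurable_pi_lambda _ hmeas)
    (h2.ae_le (ae_notMem_range_blockChart n p q (dimRatio p q + 1)))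
  filter_upwards [h3] with ω hω
  exact exists_isGeneric hp hq hω

end Genericity

/-! ### Existence and boundedness of the raw estimates -/

section RawEstimates

variable {n p q : ℕ}

theorem IsCorruption.exists_subset {k : ℕ} {X Y : Sample n p q} (h : IsCorruption k X Y)
    {A : Finset (Fin n)} {c : ℕ} (hA : k + c ≤ A.card) :
    ∃ I ⊆ A, I.card = c ∧ ∀ i ∈ I, Y i = X i := by
  classical
  have h1 : (Finset.univ.filter fun i => Y i ≠ X i).card ≤ k := by
    rw [IsCorruption, Set.ncard_eq_toFinset_card'] at h
    simpa using h
  have h2 : c ≤ (A \ Finset.univ.filter fun i => Y i ≠ X i).card := by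
    have := Finset.le_card_sdiff (Finset.univ.filter fun i => Y i ≠ X i) A
    omega
  obtain ⟨I, hI, hIc⟩ := Finset.exists_subset_card_eq h2
  refine ⟨I, hI.trans Finset.sdiff_subset, hIc, fun i hi => ?_⟩
  have := hI hi
  simpa using (Finset.mem_sdiff.1 this).2

theorem InGeneralPosition.congr {ε : ℝ} {X Y : Sample n p q} {I : Finset (Fin n)}
    (h : InGeneralPosition ε X I) (hXY : ∀ i ∈ I, Y i = X i) : InGeneralPosition ε Y I := by
  intro S T hS hT
  refine (h S T hS hT).mono le_rfl fun j k => le_of_eq ?_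
  exact Finset.sum_congr rfl fun i hi => Finset.sum_congr rfl fun i' hi' => by
    rw [hXY i hi, hXY i' hi']

/-- At most k members of A are corrupted, so d + 2 clean ones remain, and these are in general
position. -/
theorem IsGeneric.exists_inGeneralPosition {ε : ℝ} {k : ℕ} {X Y : Sample n p q}
    (hX : IsGeneric ε X) (h : IsCorruption k X Y) {A : Finset (Fin n)}
    (hA : k + (dimRatio p q + 2) ≤ A.card) :
    ∃ I ⊆ A, I.Nonempty ∧ (∀ i ∈ I, Y i = X i) ∧ InGeneralPosition ε Y I := by
  obtain ⟨I, hIA, hIc, hI⟩ := h.exists_subset hA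
  exact ⟨I, hIA, Finset.card_pos.1 (by omega), hI, (hX I hIc).congr hI⟩

/-- The weights of a subset. -/
def subsetWeights (H : Finset (Fin n)) (i : Fin n) : ℝ := if i ∈ H then 1 else 0

theorem subsetWeights_nonneg (H : Finset (Fin n)) (i : Fin n) : 0 ≤ subsetWeights H i := by
  unfold subsetWeights; split_ifs <;> norm_num

theorem sum_subsetWeights (H : Finset (Fin n)) : ∑ i, subsetWeights H i = H.card := by
  simp [subsetWeights]

theorem isSubsetMLE_iff {Y : Sample n p q} {H : Finset (Fin n)} {θ : Params p q} :
    IsSubsetMLE Y H θ ↔ IsWeightedMLE Y (subsetWeights H) θ := Iff.rfl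

theorem isWeightedMLE_congr {X Y : Sample n p q} {v : Fin n → ℝ} {θ : Params p q}
    (h : ∀ i, v i ≠ 0 → Y i = X i) : IsWeightedMLE Y v θ ↔ IsWeightedMLE X v θ := by
  have key : ∀ {r s : ℕ} (f : Matrix (Fin p) (Fin q) ℝ → Matrix (Fin r) (Fin s) ℝ),
      ∑ i, v i • f (Y i) = ∑ i, v i • f (X i) := by
    intro r s f
    refine Finset.sum_congr rfl fun i _ => ?_
    by_cases hv : v i = 0
    · rw [hv, zero_smul, zero_smul]
    · rw [h i hv]
  unfold IsWeightedMLE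
  rw [key fun Z => Z, key fun Z => (Z - θ.loc) * θ.col⁻¹ * (Z - θ.loc)ᵀ,
    key fun Z => (Z - θ.loc)ᵀ * θ.row⁻¹ * (Z - θ.loc)]

theorem isSubsetMLE_congr {X Y : Sample n p q} {H : Finset (Fin n)} {θ : Params p q}
    (h : ∀ i ∈ H, Y i = X i) : IsSubsetMLE Y H θ ↔ IsSubsetMLE X H θ :=
  isWeightedMLE_congr fun i hi => h i (by by_contra hiH; simp [hiH] at hi)

theorem likelihood_congr {X Y : Sample n p q} {v : Fin n → ℝ} {θ : Params p q}
    (h : ∀ i, v i ≠ 0 → Y i = X i) : likelihood Y v θ = likelihood X v θ := by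
  unfold likelihood
  congr 2
  refine Finset.sum_congr rfl fun i _ => ?_
  by_cases hv : v i = 0
  · rw [hv, zero_mul, zero_mul]
  · rw [h i hv]

/-- The standard parameter `(0, 1, 1)`. -/
def standardParams (p q : ℕ) : Params p q := ⟨0, 1, 1, PosDef.one, PosDef.one⟩

theorem objective_standardParams : objective (standardParams p q) = 0 := by
  simp [objective, standardParams]

theorem mahalanobisSq_standardParams (Z : Matrix (Fin p) (Fin q) ℝ) :
    mahalanobisSq (Z - (standardParams p q).loc) (standardParams p q).row (standardParams p q).col =
      ∑ j, ∑ k, Z j k ^ 2 := by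
  simp [mahalanobisSq, standardParams, sum_sq_eq_trace]

/-- Each spectral factor exp(a j + b k) is at least exp(-C). -/
theorem SpectrumBounded.sum_sq_le {C : ℝ} {A : Matrix (Fin p) (Fin p) ℝ}
    {B : Matrix (Fin q) (Fin q) ℝ} {hA : A.PosDef} {hB : B.PosDef}
    (h : SpectrumBounded C A B hA hB) (Z : Matrix (Fin p) (Fin q) ℝ) :
    ∑ j, ∑ k, Z j k ^ 2 ≤ Real.exp C * mahalanobisSq Z A B := by
  obtain ⟨S, hS, hA'⟩ := posDef_spectral hA
  obtain ⟨T, hT, hB'⟩ := posDef_spectral hB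
  have h1 := mahalanobisSq_spectral hS hT (fun j => -Real.log (hA.isHermitian.eigenvalues j))
    (fun k => -Real.log (hB.isHermitian.eigenvalues k)) Z
  rw [← hA', ← hB'] at h1
  rw [h1, ← sum_sq_orthogonal hS hT Z, Finset.mul_sum]
  refine Finset.sum_le_sum fun j _ => ?_
  rw [Finset.mul_sum]
  refine Finset.sum_le_sum fun k _ => ?_
  have h2 := (abs_le.1 (h j k)).1
  calc (Sᵀ * Z * T) j k ^ 2 = (Sᵀ * Z * T) j k ^ 2 * 1 := (mul_one _).symm
    _ ≤ (Sᵀ * Z * T) j k ^ 2 * Real.exp (C + (-Real.log (hA.isHermitian.eigenvalues j) +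
          -Real.log (hB.isHermitian.eigenvalues k))) :=
        mul_le_mul_of_nonneg_left (Real.one_le_exp (by linarith)) (sq_nonneg _)
    _ = _ := by rw [Real.exp_add]; ring

theorem SpectrumBounded.abs_entry_le {C : ℝ} {A : Matrix (Fin p) (Fin p) ℝ}
    {B : Matrix (Fin q) (Fin q) ℝ} {hA : A.PosDef} {hB : B.PosDef}
    (h : SpectrumBounded C A B hA hB) {Z : Matrix (Fin p) (Fin q) ℝ} {τ : ℝ}
    (hZ : mahalanobisSq Z A B ≤ τ) (j : Fin p) (k : Fin q) : |Z j k| ≤ √(Real.exp C * τ) := by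
  apply Real.abs_le_sqrt
  refine le_trans ?_ ((h.sum_sq_le Z).trans (mul_le_mul_of_nonneg_left hZ (Real.exp_pos _).le))
  exact (Finset.single_le_sum (f := fun k => Z j k ^ 2) (fun _ _ => sq_nonneg _)
    (Finset.mem_univ k)).trans (Finset.single_le_sum (f := fun j => ∑ k, Z j k ^ 2)
      (fun _ _ => Finset.sum_nonneg fun _ _ => sq_nonneg _) (Finset.mem_univ j))

variable {h k : ℕ} {ε : ℝ} {X : Sample n p q}

theorem exists_isSubsetMLE (hp : 0 < p) (hq : 0 < q) (hε : 0 < ε) (hX : IsGeneric ε X)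
    (hk : k + (dimRatio p q + 2) ≤ h) {Y : Sample n p q} (hY : IsCorruption k X Y)
    {H : Finset (Fin n)} (hH : H.card = h) : ∃ θ, IsSubsetMLE Y H θ := by
  obtain ⟨I, hIH, hIn, -, hI⟩ := hX.exists_inGeneralPosition hY (A := H) (by omega)
  exact exists_isWeightedMLE hp hq hε hI hIn (subsetWeights_nonneg H)
    fun i hi => by simp [hIH hi]

/-- Raw estimates minimize the likelihood of all subsets simultaneously. -/
theorem rawMMCD_le_likelihood (hp : 0 < p) (hq : 0 < q) {Y : Sample n p q} {θ : Params p q}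
    (hθ : θ ∈ rawMMCD h Y) {H : Finset (Fin n)} (hH : H.card = h) (η : Params p q) :
    p * q + objective θ ≤ likelihood Y (subsetWeights H) η := by
  obtain ⟨θ', hθ'⟩ := hθ.1 H hH
  obtain ⟨_, _, _, _, hmin⟩ := hθ
  have h1 := hmin H θ' hH hθ'
  have h2 := mle_le_likelihood hp hq (subsetWeights_nonneg H) (isSubsetMLE_iff.1 hθ') η
  linarith

/-- Here minimality is tested against the likelihood at every parameter instead of against other
estimates. For fixed η this is a closed condition on the sample, as the compactness argument
requires. -/
theorem mem_rawMMCD_of_le_likelihood (hp : 0 < p) (hq : 0 < q) (hε : 0 < ε) (hX : IsGeneric ε X)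
    (hk : k + (dimRatio p q + 2) ≤ h) {Y : Sample n p q} (hY : IsCorruption k X Y)
    {θ : Params p q} {H : Finset (Fin n)} (hH : H.card = h) (hθ : IsSubsetMLE Y H θ)
    (hmin : ∀ (H' : Finset (Fin n)) (η : Params p q), H'.card = h →
      p * q + objective θ ≤ likelihood Y (subsetWeights H') η) : θ ∈ rawMMCD h Y := by
  refine ⟨fun H hH => exists_isSubsetMLE hp hq hε hX hk hY hH, H, hH, hθ, fun H' θ' hH' hθ' => ?_⟩
  have h1 := hmin H' θ' hH'
  have h2 := likelihood_mle hp hq (subsetWeights_nonneg H') (isSubsetMLE_iff.1 hθ')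
  linarith

/-- Only finitely many subsets compete, and all estimates of one subset share the minimal
likelihood, so one chosen estimate per subset suffices. -/
theorem rawMMCD_nonempty (hp : 0 < p) (hq : 0 < q) (hε : 0 < ε) (hX : IsGeneric ε X)
    (hhn : h ≤ n) (hk : k + (dimRatio p q + 2) ≤ h) {Y : Sample n p q} (hY : IsCorruption k X Y) :
    (rawMMCD h Y).Nonempty := by
  have hex : ∀ H : Finset (Fin n), ∃ θ : Params p q, H.card = h → IsSubsetMLE Y H θ := by
    intro H
    by_cases hH : H.card = h
    · obtain ⟨θ, hθ⟩ := exists_isSubsetMLE hp hq hε hX hk hY hH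
      exact ⟨θ, fun _ => hθ⟩
    · exact ⟨standardParams p q, fun h => absurd h hH⟩
  choose θ hθ using hex
  obtain ⟨H, hH, hmin⟩ := Finset.exists_min_image (Finset.univ.powersetCard h)
    (fun H => objective (θ H)) (Finset.powersetCard_nonempty.2 (by simpa using hhn))
  have hHc : H.card = h := (Finset.mem_powersetCard.1 hH).2
  refine ⟨θ H, mem_rawMMCD_of_le_likelihood hp hq hε hX hk hY hHc (hθ H hHc) fun H' η hH' => ?_⟩
  have h1 := hmin H' (Finset.mem_powersetCard.2 ⟨Finset.subset_univ _, hH'⟩)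
  have h2 := mle_le_likelihood hp hq (subsetWeights_nonneg H') (isSubsetMLE_iff.1 (hθ H' hH')) η
  linarith

/-- The squared distances in H are nonnegative with mean pq, so none exceeds their sum. -/
theorem mahalanobisSq_le_of_isSubsetMLE (hp : 0 < p) (hq : 0 < q) {Y : Sample n p q}
    {H : Finset (Fin n)} {θ : Params p q} (hθ : IsSubsetMLE Y H θ) {i : Fin n} (hi : i ∈ H) :
    mahalanobisSq (Y i - θ.loc) θ.row θ.col ≤ H.card * (p * q) := by
  have h1 := sum_mahalanobisSq_mle hp hq (subsetWeights_nonneg H) (isSubsetMLE_iff.1 hθ)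
  rw [sum_subsetWeights] at h1
  have hH : (0 : ℝ) < H.card := by exact_mod_cast Finset.card_pos.2 ⟨i, hi⟩
  rw [inv_mul_eq_iff_eq_mul₀ hH.ne'] at h1
  rw [← h1]
  have h2 := Finset.single_le_sum (f := fun i => subsetWeights H i *
    mahalanobisSq (Y i - θ.loc) θ.row θ.col) (fun i _ => mul_nonneg (subsetWeights_nonneg H i)
      (mahalanobisSq_nonneg _ θ.row_posDef θ.col_posDef)) (Finset.mem_univ i)
  simpa [subsetWeights, hi] using h2

/-- Raw estimates are bounded, uniformly over corrupted samples, and so are the observations with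
bounded distance, in particular those that the estimate is based on. -/
theorem exists_rawMMCD_bound (hp : 0 < p) (hq : 0 < q) (hε : 0 < ε) (hX : IsGeneric ε X)
    (hkn : k + h ≤ n) (hk : k + (dimRatio p q + 2) ≤ h) (τ : ℝ) :
    ∃ C R : ℝ, 0 ≤ R ∧ (∀ i j k, |X i j k| ≤ R) ∧
      ∀ (Y : Sample n p q), IsCorruption k X Y → ∀ θ ∈ rawMMCD h Y,
        SpectrumBounded C θ.row θ.col θ.row_posDef θ.col_posDef ∧ (∀ j k, |θ.loc j k| ≤ R) ∧
        (∀ i, mahalanobisSq (Y i - θ.loc) θ.row θ.col ≤ τ → ∀ j k, |Y i j k| ≤ R) ∧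
        ∀ H : Finset (Fin n), H.card = h → IsSubsetMLE Y H θ → ∀ i ∈ H, ∀ j k, |Y i j k| ≤ R := by
  have hh : 0 < h := by omega
  have hn : 0 < n := by omega
  have hh' : (0 : ℝ) < h := by exact_mod_cast hh
  -- Summing over all H makes the bound independent of which clean subset a given corruption leaves.
  set C₀ : ℝ := ∑ H : Finset (Fin n), |likelihood X (subsetWeights H) (standardParams p q)| with hC₀
  obtain ⟨C, hC⟩ := exists_spectrumBounded hp hq hn hε one_pos hh' C₀
  set R₀ : ℝ := ∑ i, ∑ j, ∑ k, |X i j k| with hR₀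
  have hXR : ∀ i j k, |X i j k| ≤ R₀ := fun i j k =>
    (Finset.single_le_sum (f := fun k => |X i j k|) (fun _ _ => abs_nonneg _)
      (Finset.mem_univ k)).trans ((Finset.single_le_sum (f := fun j => ∑ k, |X i j k|)
        (fun _ _ => by positivity) (Finset.mem_univ j)).trans
        (Finset.single_le_sum (f := fun i => ∑ j, ∑ k, |X i j k|)
          (fun _ _ => by positivity) (Finset.mem_univ i)))
  have hR₀0 : 0 ≤ R₀ := by positivity
  set R₁ := √(Real.exp C * (h * (p * q))) with hR₁
  set R₂ := √(Real.exp C * τ) with hR₂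
  have hR₁0 : 0 ≤ R₁ := Real.sqrt_nonneg _
  have hR₂0 : 0 ≤ R₂ := Real.sqrt_nonneg _
  refine ⟨C, R₀ + 2 * R₁ + R₂, by positivity, fun i j k => by linarith [hXR i j k], ?_⟩
  intro Y hY θ hθ
  obtain ⟨H₁, -, hH₁c, hH₁⟩ := hY.exists_subset (A := Finset.univ) (c := h) (by simpa using hkn)
  have hobj : p * q + objective θ ≤ C₀ := by
    refine (rawMMCD_le_likelihood hp hq hθ hH₁c (standardParams p q)).trans ?_
    rw [likelihood_congr (X := X) fun i hi => hH₁ i (by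
      by_contra hiH; simp [subsetWeights, hiH] at hi)]
    exact (le_abs_self _).trans (Finset.single_le_sum
      (f := fun H => |likelihood X (subsetWeights H) (standardParams p q)|)
      (fun _ _ => abs_nonneg _) (Finset.mem_univ H₁))
  obtain ⟨-, H, hHc, hHθ, -⟩ := hθ
  have hHd : ∀ H : Finset (Fin n), H.card = h → IsSubsetMLE Y H θ → ∀ i ∈ H,
      mahalanobisSq (Y i - θ.loc) θ.row θ.col ≤ h * (p * q) := by
    intro H hHc hHθ i hi
    rw [← hHc]
    exact mahalanobisSq_le_of_isSubsetMLE hp hq hHθ hi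
  -- The clean observations in the optimal subset yield the spectral bound, and one of them anchors
  -- the location.
  obtain ⟨I, hIH, ⟨i₀, hi₀⟩, hIY, hI⟩ := hX.exists_inGeneralPosition hY (A := H) (by omega)
  have hsum : ∑ i, subsetWeights H i = h := by rw [sum_subsetWeights, hHc]
  have hspec : SpectrumBounded C θ.row θ.col θ.row_posDef θ.col_posDef := by
    refine hC Y I (subsetWeights H) θ hI (subsetWeights_nonneg H)
      (fun i hi => by simp [subsetWeights, hIH hi]) (by rw [hsum]; exact hh') hsum.le ?_
    rw [likelihood_mle hp hq (subsetWeights_nonneg H) (isSubsetMLE_iff.1 hHθ)]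
    exact hobj
  have hloc : ∀ j k, |θ.loc j k| ≤ R₀ + R₁ := by
    intro j k
    have h1 := hspec.abs_entry_le (hHd H hHc hHθ i₀ (hIH hi₀)) j k
    rw [hIY i₀ hi₀, Matrix.sub_apply] at h1
    have h2 := abs_sub_abs_le_abs_sub (θ.loc j k) (X i₀ j k)
    rw [abs_sub_comm] at h2
    linarith [hXR i₀ j k]
  have hpt : ∀ i j k (r : ℝ), |(Y i - θ.loc) j k| ≤ r → |Y i j k| ≤ R₀ + R₁ + r := by
    intro i j k r hr
    rw [Matrix.sub_apply] at hr
    have h2 := abs_sub_abs_le_abs_sub (Y i j k) (θ.loc j k)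
    linarith [hloc j k]
  refine ⟨hspec, fun j k => by linarith [hloc j k], fun i hi j k => ?_, fun H hHc hHθ i hi j k => ?_⟩
  · linarith [hpt i j k _ (hspec.abs_entry_le hi j k)]
  · linarith [hpt i j k _ (hspec.abs_entry_le (hHd H hHc hHθ i hi) j k)]

end RawEstimates

/-! ### A uniform lower bound for sufficiently many weights -/

section UniformWeights

variable {n p q : ℕ}

/-- A sample together with a location matrix and two covariance matrices in spectral form. -/
abbrev SpectralPoint (n p q : ℕ) : Type :=
  Sample n p q × Matrix (Fin p) (Fin q) ℝ × Matrix (Fin p) (Fin p) ℝ × Matrix (Fin q) (Fin q) ℝ ×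
    (Fin p → ℝ) × (Fin q → ℝ)

theorem continuous_spectralMatrix {α : Type*} [TopologicalSpace α]
    {S : α → Matrix (Fin p) (Fin p) ℝ} {a : α → Fin p → ℝ} (hS : Continuous S)
    (ha : Continuous a) : Continuous fun x => spectralMatrix (S x) (a x) := by
  unfold spectralMatrix
  fun_prop

/-- The closed conditions that describe raw estimates based on `H`, at samples that agree with `X`
outside `A`. -/
def rawConditions (h : ℕ) (X : Sample n p q) (A H : Finset (Fin n)) : Set (SpectralPoint n p q) :=
  {x | (∀ i, i ∉ A → x.1 i = X i) ∧
    x.2.1 = (∑ i, subsetWeights H i)⁻¹ • ∑ i, subsetWeights H i • x.1 i ∧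
    spectralMatrix x.2.2.1 x.2.2.2.2.1 = ((q : ℝ) * ∑ i, subsetWeights H i)⁻¹ •
      ∑ i, subsetWeights H i • ((x.1 i - x.2.1) *
        spectralMatrix x.2.2.2.1 (fun k => -x.2.2.2.2.2 k) * (x.1 i - x.2.1)ᵀ) ∧
    spectralMatrix x.2.2.2.1 x.2.2.2.2.2 = ((p : ℝ) * ∑ i, subsetWeights H i)⁻¹ •
      ∑ i, subsetWeights H i • ((x.1 i - x.2.1)ᵀ *
        spectralMatrix x.2.2.1 (fun j => -x.2.2.2.2.1 j) * (x.1 i - x.2.1)) ∧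
    ∀ (H' : Finset (Fin n)) (η : Params p q), H'.card = h →
      p * q - (q * ∑ j, x.2.2.2.2.1 j + p * ∑ k, x.2.2.2.2.2 k) ≤
        likelihood x.1 (subsetWeights H') η}

/-- Inverses are encoded by changing the sign of the exponents, so every condition compares
continuous functions; the likelihood at a fixed η is continuous in the sample. -/
theorem isClosed_rawConditions (h : ℕ) (X : Sample n p q) (A H : Finset (Fin n)) :
    IsClosed (rawConditions h X A H) := by
  have c1 : Continuous fun x : SpectralPoint n p q => spectralMatrix x.2.2.1 x.2.2.2.2.1 :=
    continuous_spectralMatrix (by fun_prop) (by fun_prop)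
  have c2 : Continuous fun x : SpectralPoint n p q => spectralMatrix x.2.2.2.1 x.2.2.2.2.2 :=
    continuous_spectralMatrix (by fun_prop) (by fun_prop)
  have c3 : Continuous fun x : SpectralPoint n p q =>
      spectralMatrix x.2.2.1 (fun j => -x.2.2.2.2.1 j) :=
    continuous_spectralMatrix (by fun_prop) (by fun_prop)
  have c4 : Continuous fun x : SpectralPoint n p q =>
      spectralMatrix x.2.2.2.1 (fun k => -x.2.2.2.2.2 k) :=
    continuous_spectralMatrix (by fun_prop) (by fun_prop)
  simp only [rawConditions, Set.ofPred_and, Set.ofPred_forall]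
  refine IsClosed.inter ?_ (IsClosed.inter ?_ (IsClosed.inter ?_ (IsClosed.inter ?_ ?_)))
  · exact isClosed_iInter fun i => isClosed_iInter fun _ => isClosed_eq (by fun_prop) (by fun_prop)
  · exact isClosed_eq (by fun_prop) (by fun_prop)
  · exact isClosed_eq c1 (by fun_prop)
  · exact isClosed_eq c2 (by fun_prop)
  · refine isClosed_iInter fun H' => isClosed_iInter fun η => isClosed_iInter fun _ =>
      isClosed_le (by fun_prop) ?_
    unfold likelihood mahalanobisSq
    fun_prop

/-- The Mahalanobis distance in spectral coordinates. -/
noncomputable def spectralDistance (x : SpectralPoint n p q) (i : Fin n) : ℝ :=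
  √ (∑ j, ∑ k, (x.2.2.1ᵀ * (x.1 i - x.2.1) * x.2.2.2.1) j k ^ 2 *
    Real.exp (x.2.2.2.2.1 j + x.2.2.2.2.2 k))

theorem continuous_spectralDistance (i : Fin n) :
    Continuous fun x : SpectralPoint n p q => spectralDistance x i := by
  unfold spectralDistance
  fun_prop

theorem mmd_eq (Z : Matrix (Fin p) (Fin q) ℝ) (θ : Params p q) :
    mmd Z θ = √ (mahalanobisSq (Z - θ.loc) θ.row θ.col) := rfl

/-- The compact region of spectral points. -/
def spectralBox (n p q : ℕ) (R C : ℝ) : Set (SpectralPoint n p q) :=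
  {Y | ∀ i j k, |Y i j k| ≤ R} ×ˢ {M | ∀ j k, |M j k| ≤ R} ×ˢ {S | Sᵀ * S = 1} ×ˢ
    {T | Tᵀ * T = 1} ×ˢ {a | ∀ j, |a j| ≤ 2 * C} ×ˢ {b | ∀ k, |b k| ≤ C}

theorem isCompact_spectralBox (n p q : ℕ) (R C : ℝ) : IsCompact (spectralBox n p q R C) := by
  have h : IsCompact {Y : Sample n p q | ∀ i j k, |Y i j k| ≤ R} := by
    have := isCompact_univ_pi fun _ : Fin n => isCompact_matrix_box p q R
    convert this using 1
    ext Y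
    simp [Set.mem_pi]
  exact h.prod ((isCompact_matrix_box p q R).prod ((isCompact_orthogonal p).prod
    ((isCompact_orthogonal q).prod ((isCompact_vector_box p _).prod (isCompact_vector_box q _)))))

variable {h k : ℕ} {ε : ℝ} {X : Sample n p q}

/-- The parameter of a spectral point. -/
noncomputable def ofSpectral (M : Matrix (Fin p) (Fin q) ℝ) {S : Matrix (Fin p) (Fin p) ℝ}
    {T : Matrix (Fin q) (Fin q) ℝ} (hS : Sᵀ * S = 1) (hT : Tᵀ * T = 1) (a : Fin p → ℝ)
    (b : Fin q → ℝ) : Params p q :=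
  ⟨M, spectralMatrix S a, spectralMatrix T b, spectralMatrix_posDef hS a, spectralMatrix_posDef hT b⟩

theorem objective_ofSpectral (M : Matrix (Fin p) (Fin q) ℝ) {S : Matrix (Fin p) (Fin p) ℝ}
    {T : Matrix (Fin q) (Fin q) ℝ} (hS : Sᵀ * S = 1) (hT : Tᵀ * T = 1) (a : Fin p → ℝ)
    (b : Fin q → ℝ) : objective (ofSpectral M hS hT a b) = -(q * ∑ j, a j + p * ∑ k, b k) := by
  simp only [objective, ofSpectral, spectralMatrix]
  rw [log_det_spectral hS, log_det_spectral hT]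
  ring

/-- Points satisfying the raw conditions are raw estimates. -/
theorem mem_rawMMCD_of_rawConditions (hp : 0 < p) (hq : 0 < q) (hε : 0 < ε)
    (hX : IsGeneric ε X) (hk : k + (dimRatio p q + 2) ≤ h) {A H : Finset (Fin n)}
    (hA : A.card ≤ k) (hH : H.card = h) {Y : Sample n p q} {M : Matrix (Fin p) (Fin q) ℝ}
    {S : Matrix (Fin p) (Fin p) ℝ} {T : Matrix (Fin q) (Fin q) ℝ} (hS : Sᵀ * S = 1)
    (hT : Tᵀ * T = 1) {a : Fin p → ℝ} {b : Fin q → ℝ}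
    (hx : (Y, M, S, T, a, b) ∈ rawConditions h X A H) :
    IsCorruption k X Y ∧ ofSpectral M hS hT a b ∈ rawMMCD h Y ∧
      ∀ i, mmd (Y i) (ofSpectral M hS hT a b) = spectralDistance (Y, M, S, T, a, b) i := by
  obtain ⟨h1, h2, h3, h4, h5⟩ := hx
  have hY : IsCorruption k X Y := by
    refine le_trans ?_ hA
    rw [← Set.ncard_coe_finset]
    refine Set.ncard_le_ncard (fun i hi => ?_) (Finset.finite_toSet A)
    by_contra hiA
    exact hi (h1 i hiA)
  refine ⟨hY, mem_rawMMCD_of_le_likelihood hp hq hε hX hk hY hH ?_ ?_, fun i => ?_⟩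
  · refine isSubsetMLE_iff.2 ⟨h2, ?_, ?_⟩
    · simp only [ofSpectral, spectralMatrix_inv hT]
      exact h3
    · simp only [ofSpectral, spectralMatrix_inv hS]
      exact h4
  · intro H' η hH'
    rw [objective_ofSpectral]
    have := h5 H' η hH'
    linarith
  · rw [mmd_eq, spectralDistance]
    simp only [ofSpectral, spectralMatrix]
    rw [mahalanobisSq_spectral hS hT]

/-- Raw estimates are described by normalized spectral points satisfying the raw conditions. -/
theorem exists_spectralPoint (hp : 0 < p) (hq : 0 < q) {Y : Sample n p q}
    (hY : IsCorruption k X Y) {θ : Params p q} (hθ : θ ∈ rawMMCD h Y) {C : ℝ}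
    (hC : SpectrumBounded C θ.row θ.col θ.row_posDef θ.col_posDef) :
    ∃ (A H : Finset (Fin n)) (S : Matrix (Fin p) (Fin p) ℝ) (T : Matrix (Fin q) (Fin q) ℝ)
      (a : Fin p → ℝ) (b : Fin q → ℝ), A.card ≤ k ∧ H.card = h ∧ Sᵀ * S = 1 ∧ Tᵀ * T = 1 ∧
      (∀ j, |a j| ≤ 2 * C) ∧ (∀ k, |b k| ≤ C) ∧
      (Y, θ.loc, S, T, a, b) ∈ rawConditions h X A H ∧
      ∀ i, mmd (Y i) θ = spectralDistance (Y, θ.loc, S, T, a, b) i := by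
  classical
  have hmin : ∀ (H' : Finset (Fin n)) (η : Params p q), H'.card = h →
      p * q + objective θ ≤ likelihood Y (subsetWeights H') η :=
    fun H' η hH' => rawMMCD_le_likelihood hp hq hθ hH' η
  obtain ⟨-, H, hH, hmle, -⟩ := hθ
  obtain ⟨S, hS, hA⟩ := posDef_spectral θ.row_posDef
  obtain ⟨T, hT, hB⟩ := posDef_spectral θ.col_posDef
  rw [← spectralMatrix] at hA hB
  set a : Fin p → ℝ := fun j => -Real.log (θ.row_posDef.isHermitian.eigenvalues j) with ha
  set b : Fin q → ℝ := fun k => -Real.log (θ.col_posDef.isHermitian.eigenvalues k) with hb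
  -- Rescaling makes the first row exponent zero, which turns the bound on sums into separate bounds
  -- on a and b.
  set t := a ⟨0, hp⟩ with ht
  have hab : ∀ j k, |a j + b k| ≤ C := hC
  obtain ⟨h1, h2, h3⟩ := isSubsetMLE_iff.1 hmle
  have hbt : (fun k => b k + t) = fun k => b k - -t := by simp
  have hat' : (fun j => -(a j - t)) = fun j => -a j - -t := by ext j; ring
  have hbt' : (fun k => -(b k + t)) = fun k => -b k - t := by ext k; ring
  have hAi : θ.row⁻¹ = spectralMatrix S (fun j => -a j) := by rw [hA, spectralMatrix_inv hS]
  have hBi : θ.col⁻¹ = spectralMatrix T (fun k => -b k) := by rw [hB, spectralMatrix_inv hT]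
  refine ⟨Finset.univ.filter fun i => Y i ≠ X i, H, S, T, fun j => a j - t, fun k => b k + t,
    ?_, hH, hS, hT, ?_, ?_, ⟨?_, h1, ?_, ?_, ?_⟩, ?_⟩
  · rw [IsCorruption, Set.ncard_eq_toFinset_card'] at hY
    simpa using hY
  · intro j
    have e1 := abs_le.1 (hab j ⟨0, hq⟩)
    have e2 := abs_le.1 (hab ⟨0, hp⟩ ⟨0, hq⟩)
    exact abs_le.2 ⟨by linarith, by linarith⟩
  · intro k
    have e1 := abs_le.1 (hab ⟨0, hp⟩ k)
    exact abs_le.2 ⟨by linarith, by linarith⟩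
  · intro i hi
    simpa using hi
  · simp only
    rw [spectralMatrix_sub_const, ← hA, hbt', spectralMatrix_sub_const, ← hBi]
    conv_lhs => rw [h2]
    simp only [Matrix.mul_smul, Matrix.smul_mul, smul_comm _ (Real.exp t), ← Finset.smul_sum]
  · simp only
    rw [hbt, spectralMatrix_sub_const, ← hB, hat', spectralMatrix_sub_const, ← hAi]
    conv_lhs => rw [h3]
    simp only [Matrix.mul_smul, Matrix.smul_mul, smul_comm _ (Real.exp (-t)), ← Finset.smul_sum]
  · intro H' η hH'
    have e1 := hmin H' η hH'
    have e2 : objective θ = -(q * ∑ j, a j + p * ∑ k, b k) := by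
      rw [objective, hA, hB, spectralMatrix, spectralMatrix, log_det_spectral hS,
        log_det_spectral hT]
      ring
    rw [e2] at e1
    simp only [Finset.sum_add_distrib, Finset.sum_sub_distrib, Finset.sum_const, Finset.card_univ,
      Fintype.card_fin, nsmul_eq_mul]
    linarith
  · intro i
    rw [mmd_eq, spectralDistance, hA, hB, spectralMatrix, spectralMatrix,
      mahalanobisSq_spectral hS hT]
    simp only [sub_add_add_cancel]

/-- Replacement of all observations with a large entry by one fixed matrix. -/
noncomputable def truncate (R : ℝ) (Y : Sample n p q) : Sample n p q :=
  open Classical in fun i => if ∀ j k, |Y i j k| ≤ R then Y i else of fun _ _ => R + 1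

theorem truncate_eq {R : ℝ} {Y : Sample n p q} {i : Fin n} (h : ∀ j k, |Y i j k| ≤ R) :
    truncate R Y i = Y i := by
  rw [truncate, if_pos h]

theorem abs_truncate_le {R : ℝ} (hR : 0 ≤ R) (Y : Sample n p q) (i : Fin n) (j : Fin p)
    (k : Fin q) : |truncate R Y i j k| ≤ R + 1 := by
  unfold truncate
  split_ifs with h
  · linarith [h j k]
  · rw [of_apply, abs_of_nonneg (by linarith)]

/-- The substitute has entries R + 1 > R, so an observation within the bound after truncation was
never replaced. -/
theorem eq_truncate (hp : 0 < p) (hq : 0 < q) {R : ℝ} {Y : Sample n p q} {i : Fin n}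
    (h : ∀ j k, |truncate R Y i j k| ≤ R) : truncate R Y i = Y i := by
  unfold truncate at h ⊢
  split_ifs with hY
  · rfl
  · have := h ⟨0, hp⟩ ⟨0, hq⟩
    rw [if_neg hY, of_apply] at this
    linarith [le_abs_self (R + 1)]

/-- Clean observations lie within the bound, so truncation alters only corrupted ones. -/
theorem IsCorruption.truncate {R : ℝ} {Y : Sample n p q} (hX : ∀ i j k, |X i j k| ≤ R)
    (hY : IsCorruption k X Y) : IsCorruption k X (truncate R Y) := by
  refine le_trans (Set.ncard_le_ncard (fun i hi => ?_) (Set.toFinite _)) hY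
  intro he
  refine hi ?_
  rw [truncate_eq (fun j k => by rw [he]; exact hX i j k), he]

/-- Truncation at a level above all raw estimates does not affect raw estimates. -/
theorem mem_rawMMCD_truncate (hp : 0 < p) (hq : 0 < q) (hε : 0 < ε) (hX : IsGeneric ε X)
    (hhn : h ≤ n) (hk : k + (dimRatio p q + 2) ≤ h) {R : ℝ} (hXR : ∀ i j k, |X i j k| ≤ R)
    (hR : ∀ (Y : Sample n p q), IsCorruption k X Y → ∀ θ ∈ rawMMCD h Y,
      ∀ H : Finset (Fin n), H.card = h → IsSubsetMLE Y H θ → ∀ i ∈ H, ∀ j k, |Y i j k| ≤ R)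
    {Y : Sample n p q} (hY : IsCorruption k X Y) {θ : Params p q} (hθ : θ ∈ rawMMCD h Y) :
    θ ∈ rawMMCD h (truncate R Y) := by
  have hY' : IsCorruption k X (truncate R Y) := hY.truncate hXR
  refine ⟨fun H hH => exists_isSubsetMLE hp hq hε hX hk hY' hH, ?_⟩
  obtain ⟨-, H, hH, hmle, hmin⟩ := id hθ
  refine ⟨H, hH, ?_, fun H' θ' hH' hθ' => ?_⟩
  · exact (isSubsetMLE_congr fun i hi => truncate_eq (hR Y hY θ hθ H hH hmle i hi)).2 hmle
  -- A raw estimate `θ₁` of the truncated sample rests on untruncated observations, so it is also a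
  -- subset estimate of `Y`. Hence `θ` does not lose against `θ₁`, which in turn does not lose
  -- against any competitor.
  · obtain ⟨θ₁, hθ₁⟩ := rawMMCD_nonempty hp hq hε hX hhn hk hY'
    obtain ⟨-, H₁, hH₁, hmle₁, hmin₁⟩ := id hθ₁
    refine (hmin H₁ θ₁ hH₁ ?_).trans (hmin₁ H' θ' hH' hθ')
    exact (isSubsetMLE_congr fun i hi =>
      eq_truncate hp hq (hR _ hY' θ₁ hθ₁ H₁ hH₁ hmle₁ i hi)).1 hmle₁

theorem mahalanobisSq_le_of_mmd_le {Z : Matrix (Fin p) (Fin q) ℝ} {θ : Params p q} {c : ℝ}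
    (h : mmd Z θ ≤ c) : mahalanobisSq (Z - θ.loc) θ.row θ.col ≤ c ^ 2 := by
  rw [mmd_eq] at h
  exact (Real.sqrt_le_left ((Real.sqrt_nonneg _).trans h)).1 h

theorem IsWeightFunction.le_cutoff {w : ℝ → ℝ} {c₁ t : ℝ} (hw : IsWeightFunction w c₁)
    (ht : 0 < w t) : t ≤ c₁ := by
  by_contra! hlt
  rw [hw.vanish t hlt] at ht
  exact lt_irrefl _ ht

/-- Uniformly over corrupted samples, many observations have distances in a range where the weight
function is bounded away from zero. -/
theorem exists_uniform_distance (hp : 0 < p) (hq : 0 < q) (hε : 0 < ε) (hX : IsGeneric ε X)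
    (hkn : k + h ≤ n) (hk : k + (dimRatio p q + 2) ≤ h) {w : ℝ → ℝ} {c₁ : ℝ}
    (hw : IsWeightFunction w c₁)
    (hW : ∀ Y : Sample n p q, IsCorruption k X Y → HasEnoughPositiveWeights h w Y) :
    ∃ t : ℝ, 0 ≤ t ∧ 0 < w t ∧ ∀ Y : Sample n p q, IsCorruption k X Y → ∀ θ ∈ rawMMCD h Y,
      (n + dimRatio p q + 2) / 2 ≤ (Finset.univ.filter fun i => mmd (Y i) θ ≤ t).card := by
  classical
  set N := (n + dimRatio p q + 2) / 2 with hN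
  have hmmd : ∀ (Z : Matrix (Fin p) (Fin q) ℝ) (θ : Params p q), 0 ≤ mmd Z θ := fun Z θ =>
    Real.sqrt_nonneg _
  -- If the set where w is positive has a largest element, that element is the required t. Otherwise
  -- weights could approach zero near its supremum, and compactness is needed.
  by_cases hmax : ∃ t, 0 ≤ t ∧ 0 < w t ∧ ∀ s, 0 ≤ s → 0 < w s → s ≤ t
  · obtain ⟨t, ht0, htw, ht⟩ := hmax
    refine ⟨t, ht0, htw, fun Y hY θ hθ => (hW Y hY θ hθ).trans (Finset.card_le_card ?_)⟩
    intro i hi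
    simp only [Finset.mem_filter, Finset.mem_univ, true_and] at hi ⊢
    exact ht _ (hmmd _ _) hi
  push Not at hmax
  have hXX : IsCorruption k X X := by simp [IsCorruption]
  obtain ⟨C, R, hR0, hXR, hbound⟩ := exists_rawMMCD_bound hp hq hε hX hkn hk (c₁ ^ 2)
  have hne : Nonempty {t : ℝ // 0 ≤ t ∧ 0 < w t} := by
    obtain ⟨θ, hθ⟩ := rawMMCD_nonempty hp hq hε hX (by omega) hk hXX
    have h1 := hW X hXX θ hθ
    have h2 : 0 < (Finset.univ.filter fun i => 0 < w (mmd (X i) θ)).card := by omega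
    obtain ⟨i, hi⟩ := Finset.card_pos.1 h2
    exact ⟨⟨mmd (X i) θ, hmmd _ _, (Finset.mem_filter.1 hi).2⟩⟩
  set K : Set (SpectralPoint n p q) :=
    ⋃ AH : {AH : Finset (Fin n) × Finset (Fin n) // AH.1.card ≤ k ∧ AH.2.card = h},
      spectralBox n p q (R + 1) C ∩ rawConditions h X AH.1.1 AH.1.2 with hK
  have hKc : IsCompact K := isCompact_iUnion fun AH =>
    (isCompact_spectralBox n p q _ _).inter_right (isClosed_rawConditions h X _ _)
  -- `U t` consists of the points with at least N distances below t; the strict inequality makes it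
  -- open.
  set U : {t : ℝ // 0 ≤ t ∧ 0 < w t} → Set (SpectralPoint n p q) := fun t =>
    ⋃ I : {I : Finset (Fin n) // I.card = N}, ⋂ i : I.1, {x | spectralDistance x i < t.1} with hU
  have hUo : ∀ t, IsOpen (U t) := fun t => isOpen_iUnion fun I => isOpen_iInter_of_finite fun i =>
    isOpen_lt (continuous_spectralDistance _) continuous_const
  have hUmono : ∀ s t, s.1 ≤ t.1 → U s ⊆ U t := by
    intro s t hst x hx
    simp only [hU, Set.mem_iUnion, Set.mem_iInter, Set.mem_ofPred_eq] at hx ⊢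
    obtain ⟨I, hI⟩ := hx
    exact ⟨I, fun i => (hI i).trans_le hst⟩
  have hdir : Directed (· ⊆ ·) U := by
    intro s t
    rcases le_total s.1 t.1 with h | h
    · exact ⟨t, hUmono s t h, le_rfl⟩
    · exact ⟨s, le_rfl, hUmono t s h⟩
  have hcover : K ⊆ ⋃ t, U t := by
    intro x hx
    obtain ⟨⟨⟨A, H⟩, hA, hH⟩, hbox, hcond⟩ := Set.mem_iUnion.1 hx
    obtain ⟨Y, M, S, T, a, b⟩ := x
    have hS : Sᵀ * S = 1 := hbox.2.2.1
    have hT : Tᵀ * T = 1 := hbox.2.2.2.1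
    obtain ⟨hY, hraw, hdist⟩ :=
      mem_rawMMCD_of_rawConditions hp hq hε hX hk hA hH hS hT hcond
    obtain ⟨I, hIsub, hIc⟩ := Finset.exists_subset_card_eq (hW Y hY _ hraw)
    have hIn : I.Nonempty := Finset.card_pos.1 (by omega)
    obtain ⟨i₀, hi₀, hi₀max⟩ := I.exists_max_image
      (fun i => mmd (Y i) (ofSpectral M hS hT a b)) hIn
    -- As no largest distance with positive weight exists, one can go strictly beyond the largest of
    -- the N selected distances.
    obtain ⟨s, hs0, hsw, hs⟩ := hmax _ (hmmd _ _) (Finset.mem_filter.1 (hIsub hi₀)).2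
    refine Set.mem_iUnion.2 ⟨⟨s, hs0, hsw⟩, Set.mem_iUnion.2 ⟨⟨I, hIc⟩, Set.mem_iInter.2 ?_⟩⟩
    rintro ⟨i, hi⟩
    change spectralDistance (Y, M, S, T, a, b) i < s
    rw [← hdist]
    exact (hi₀max i hi).trans_lt hs
  obtain ⟨⟨t, ht0, htw⟩, htK⟩ := hKc.elim_directed_cover U hUo hcover hdir
  refine ⟨t, ht0, htw, fun Y hY θ hθ => ?_⟩
  have hY' : IsCorruption k X (truncate R Y) := hY.truncate hXR
  have hθ' : θ ∈ rawMMCD h (truncate R Y) :=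
    mem_rawMMCD_truncate hp hq hε hX (by omega) hk hXR
      (fun Y hY θ hθ => (hbound Y hY θ hθ).2.2.2) hY hθ
  obtain ⟨hspec, hloc, hpt, -⟩ := hbound _ hY' θ hθ'
  obtain ⟨A, H, S, T, a, b, hA, hH, hS, hT, ha, hb, hcond, hdist⟩ :=
    exists_spectralPoint hp hq hY' hθ' hspec
  have hxK : ((truncate R Y, θ.loc, S, T, a, b) : SpectralPoint n p q) ∈ K := by
    refine Set.mem_iUnion.2 ⟨⟨(A, H), hA, hH⟩, ⟨?_, ?_, hS, hT, ha, hb⟩, hcond⟩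
    · exact abs_truncate_le hR0 Y
    · intro j k
      linarith [hloc j k]
  obtain ⟨⟨I, hIc⟩, hI⟩ := Set.mem_iUnion.1 (htK hxK)
  rw [← hIc]
  refine Finset.card_le_card fun i hi => ?_
  have h1 : spectralDistance (truncate R Y, θ.loc, S, T, a, b) i < t := Set.mem_iInter.1 hI ⟨i, hi⟩
  rw [← hdist] at h1
  -- A distance of at most t ≤ c₁ keeps the entries within R, so the counted observations are
  -- genuine members of `Y`.
  have h2 := eq_truncate hp hq (hpt i (mahalanobisSq_le_of_mmd_le
    (h1.le.trans (hw.le_cutoff htw))))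
  rw [h2] at h1
  simpa using h1.le

end UniformWeights

/-! ### Reweighted estimates and breakdown points -/

section Reweighted

variable {n p q h k : ℕ} {ε : ℝ} {X : Sample n p q}

/-- With the uniform distance bound, enough clean observations have weights bounded below. -/
theorem exists_clean_weights (hX : IsGeneric ε X) {w : ℝ → ℝ}
    {c₁ t : ℝ} (hw : IsWeightFunction w c₁) (ht : 0 ≤ t) {Y : Sample n p q}
    (hY : IsCorruption k X Y) {θ : Params p q}
    (hN : k + (dimRatio p q + 2) ≤ (Finset.univ.filter fun i => mmd (Y i) θ ≤ t).card) :
    ∃ I : Finset (Fin n), I.Nonempty ∧ InGeneralPosition ε Y I ∧ ∀ i ∈ I, w t ≤ w (mmd (Y i) θ) := by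
  obtain ⟨I, hI, hIn, -, hIg⟩ := hX.exists_inGeneralPosition hY hN
  refine ⟨I, hIn, hIg, fun i hi => hw.antitone (Real.sqrt_nonneg _) ht ?_⟩
  exact (Finset.mem_filter.1 (hI hi)).2

/-- Reweighted estimates exist and are bounded, uniformly over corrupted samples. -/
theorem exists_reweightedMMCD_bound (hp : 0 < p) (hq : 0 < q) (hε : 0 < ε) (hX : IsGeneric ε X)
    (hkn : k + h ≤ n) (hk : k + (dimRatio p q + 2) ≤ h) {w : ℝ → ℝ} {c₁ : ℝ}
    (hw : IsWeightFunction w c₁)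
    (hW : ∀ Y : Sample n p q, IsCorruption k X Y → HasEnoughPositiveWeights h w Y) :
    ∃ C R : ℝ, ∀ Y : Sample n p q, IsCorruption k X Y → (reweightedMMCD h w Y).Nonempty ∧
      ∀ η ∈ reweightedMMCD h w Y, SpectrumBounded C η.row η.col η.row_posDef η.col_posDef ∧
        ∀ j k, |η.loc j k| ≤ R := by
  have hn : 0 < n := by omega
  have hn' : (0 : ℝ) < n := by exact_mod_cast hn
  obtain ⟨t, ht0, htw, ht⟩ := exists_uniform_distance hp hq hε hX hkn hk hw hW
  obtain ⟨C₁, R, hR0, -, hbound⟩ := exists_rawMMCD_bound hp hq hε hX hkn hk (c₁ ^ 2)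
  obtain ⟨B, hB⟩ := hw.bounded
  have hB0 : 0 < B := htw.trans_le (hB t ht0)
  obtain ⟨C, hC⟩ := exists_spectrumBounded hp hq hn hε htw (mul_pos hn' hB0) (p * (q * R ^ 2))
  have hmmd : ∀ (Z : Matrix (Fin p) (Fin q) ℝ) (θ : Params p q), 0 ≤ mmd Z θ := fun Z θ =>
    Real.sqrt_nonneg _
  refine ⟨C, R, fun Y hY => ?_⟩
  have hv : ∀ (θ : Params p q) i, 0 ≤ w (mmd (Y i) θ) := fun θ i => hw.nonneg _ (hmmd _ _)
  have hclean : ∀ θ ∈ rawMMCD h Y, ∃ I : Finset (Fin n), I.Nonempty ∧ InGeneralPosition ε Y I ∧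
      ∀ i ∈ I, w t ≤ w (mmd (Y i) θ) := fun θ hθ =>
    -- Adding k ≤ n - h and k ≤ h - (d + 2) gives 2k ≤ n - d - 2, that is k + d + 2 ≤ ⌊(n + d +
    -- 2)/2⌋.
    exists_clean_weights hX hw ht0 hY (by have := ht Y hY θ hθ; omega)
  have hex : ∀ θ ∈ rawMMCD h Y, ∃ η', IsWeightedMLE Y (fun i => w (mmd (Y i) θ)) η' := by
    intro θ hθ
    obtain ⟨I, hIn, hIg, hI⟩ := hclean θ hθ
    exact exists_isWeightedMLE hp hq hε hIg hIn (hv θ) fun i hi => htw.trans_le (hI i hi)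
  constructor
  · obtain ⟨θ, hθ⟩ := rawMMCD_nonempty hp hq hε hX (by omega) hk hY
    obtain ⟨η, hη⟩ := hex θ hθ
    exact ⟨η, hex, θ, hθ, hη⟩
  · rintro η ⟨-, θ, hθ, hη⟩
    obtain ⟨I, hIn, hIg, hI⟩ := hclean θ hθ
    set v : Fin n → ℝ := fun i => w (mmd (Y i) θ) with hvdef
    have hs : 0 < ∑ i, v i := sum_weights_pos hp (hv θ) hη
    have hsB : ∑ i, v i ≤ n * B := by
      calc ∑ i, v i ≤ ∑ _i : Fin n, B := Finset.sum_le_sum fun i _ => hB _ (hmmd _ _)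
        _ = n * B := by simp
    have hYR : ∀ i, 0 < v i → ∀ j k, |Y i j k| ≤ R := fun i hi =>
      (hbound Y hY θ hθ).2.2.1 i (mahalanobisSq_le_of_mmd_le (hw.le_cutoff hi))
    -- Observations of weight zero may be arbitrarily large, but they contribute nothing.
    have hvY : ∀ i (x r : ℝ), (0 < v i → x ≤ r) → v i * x ≤ v i * r := by
      intro i x r hx
      rcases (hv θ i).eq_or_lt with h0 | h0
      · simp [hvdef, ← h0]
      · exact mul_le_mul_of_nonneg_left (hx h0) h0.le
    constructor
    · refine hC Y I v η hIg (hv θ) hI hs hsB ?_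
      rw [likelihood_mle hp hq (hv θ) hη]
      refine (mle_le_likelihood hp hq (hv θ) hη (standardParams p q)).trans ?_
      rw [likelihood, objective_standardParams, add_zero, inv_mul_le_iff₀ hs, Finset.sum_mul]
      refine Finset.sum_le_sum fun i _ => hvY i _ _ fun hi => ?_
      rw [mahalanobisSq_standardParams]
      calc ∑ j, ∑ k, Y i j k ^ 2 ≤ ∑ _j : Fin p, ∑ _k : Fin q, R ^ 2 :=
            Finset.sum_le_sum fun j _ => Finset.sum_le_sum fun k _ =>
              sq_le_sq' (abs_le.1 (hYR i hi j k)).1 (abs_le.1 (hYR i hi j k)).2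
        _ = p * (q * R ^ 2) := by simp
    · intro j k
      rw [hη.1, Matrix.smul_apply, Matrix.sum_apply, smul_eq_mul, abs_mul,
        abs_of_pos (inv_pos.2 hs), inv_mul_le_iff₀ hs, Finset.sum_mul]
      refine (Finset.abs_sum_le_sum_abs _ _).trans (Finset.sum_le_sum fun i _ => ?_)
      rw [Matrix.smul_apply, smul_eq_mul, abs_mul, abs_of_nonneg (hv θ i)]
      exact hvY i _ _ fun hi => hYR i hi j k

theorem locationDeviation_le {R : ℝ} {θ η : Params p q} (hθ : ∀ j k, |θ.loc j k| ≤ R)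
    (hη : ∀ j k, |η.loc j k| ≤ R) :
    locationDeviation θ η ≤ ENNReal.ofReal (√ (p * (q * (2 * R) ^ 2))) := by
  refine ENNReal.ofReal_le_ofReal (Real.sqrt_le_sqrt ?_)
  rw [← sum_sq_eq_trace]
  calc ∑ j, ∑ k, (θ.loc - η.loc) j k ^ 2 ≤ ∑ _j : Fin p, ∑ _k : Fin q, (2 * R) ^ 2 := by
        refine Finset.sum_le_sum fun j _ => Finset.sum_le_sum fun k _ => ?_
        have h1 := abs_le.1 (hθ j k)
        have h2 := abs_le.1 (hη j k)
        rw [Matrix.sub_apply]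
        exact sq_le_sq' (by linarith) (by linarith)
    _ = _ := by simp

/-- The ordered eigenvalues are a reindexing of the eigenvalues in the spectral bound, which covers
all pairs and so is insensitive to order. -/
theorem SpectrumBounded.abs_log_eigenvalues₀_le {C : ℝ} {A : Matrix (Fin p) (Fin p) ℝ}
    {B : Matrix (Fin q) (Fin q) ℝ} {hA : A.PosDef} {hB : B.PosDef}
    (h : SpectrumBounded C A B hA hB) (i : Fin (Fintype.card (Fin p)))
    (j : Fin (Fintype.card (Fin q))) :
    |Real.log (hA.isHermitian.eigenvalues₀ i * hB.isHermitian.eigenvalues₀ j)| ≤ C := by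
  set e₁ := Fintype.equivOfCardEq (α := Fin (Fintype.card (Fin p))) (β := Fin p) (Fintype.card_fin _)
  set e₂ := Fintype.equivOfCardEq (α := Fin (Fintype.card (Fin q))) (β := Fin q) (Fintype.card_fin _)
  have h1 : hA.isHermitian.eigenvalues₀ i = hA.isHermitian.eigenvalues (e₁ i) := by
    rw [IsHermitian.eigenvalues, Equiv.symm_apply_apply]
  have h2 : hB.isHermitian.eigenvalues₀ j = hB.isHermitian.eigenvalues (e₂ j) := by
    rw [IsHermitian.eigenvalues, Equiv.symm_apply_apply]
  rw [h1, h2, Real.log_mul (hA.eigenvalues_pos _).ne' (hB.eigenvalues_pos _).ne', ← abs_neg, neg_add]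
  exact h _ _

theorem covarianceDeviation_le {C : ℝ} {θ η : Params p q}
    (hθ : SpectrumBounded C θ.row θ.col θ.row_posDef θ.col_posDef)
    (hη : SpectrumBounded C η.row η.col η.row_posDef η.col_posDef) :
    covarianceDeviation θ η ≤ ENNReal.ofReal (C + C) :=
  iSup₂_le fun i j => ENNReal.ofReal_le_ofReal ((abs_sub _ _).trans
    (add_le_add (hη.abs_log_eigenvalues₀_le i j) (hθ.abs_log_eigenvalues₀_le i j)))

theorem IsCorruption.mono {k k' : ℕ} {Y : Sample n p q} (h : IsCorruption k X Y) (hk : k ≤ k') :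
    IsCorruption k' X Y :=
  le_trans h hk

/-- A uniform bound for fewer than `m` replacements bounds the breakdown point from below. -/
theorem le_breakdownPoint {D : Params p q → Params p q → ℝ≥0∞} {T : Sample n p q → Set (Params p q)}
    {m : ℕ} {b : ℝ≥0∞} (hb : b ≠ ⊤)
    (hT : ∀ Y, IsCorruption (m - 1) X Y → (T Y).Nonempty)
    (hD : ∀ Y, IsCorruption (m - 1) X Y → ∀ θ ∈ T X, ∀ η ∈ T Y, D θ η ≤ b) :
    (m : ℝ≥0∞) / n ≤ breakdownPoint D T X := by
  refine le_iInf₂ fun k hk => ?_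
  obtain ⟨hk1, -, hkD⟩ := hk
  refine ENNReal.div_le_div_right ?_ _
  by_contra hlt
  have hkm : k ≤ m - 1 := by
    have : k < m := by exact_mod_cast not_le.1 hlt
    omega
  have hXX : IsCorruption (m - 1) X X := by simp [IsCorruption]
  have hle : maxDeviation D T X k ≤ b := by
    refine iSup₂_le fun Y hY => ?_
    have hY' := hY.mono hkm
    rw [if_pos ⟨hT X hXX, hT Y hY'⟩]
    exact iSup₂_le fun θ hθ => iSup₂_le fun η hη => hD Y hY' θ hθ η hη
  rw [hkD] at hle
  exact hb (top_le_iff.1 hle)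

end Reweighted

end MMCD

theorem theorem3
    {Ω : Type*} [MeasurableSpace Ω] (P : Measure Ω) [IsProbabilityMeasure P]
    (n p q h : ℕ) (hp : 2 ≤ p) (hq : 2 ≤ q)
    (hn : n ≤ 2 * h) (hhn : h ≤ n) (hh : MMCD.dimRatio p q + 2 ≤ h)
    -- an i.i.d. sample from a continuous matrix-variate distribution
    (X : Fin n → Ω → Matrix (Fin p) (Fin q) ℝ)
    (hindep : iIndepFun X P)
    (hident : ∀ i j, IdentDistrib (X i) (X j) P P)
    (hcont : ∀ i, P.map (X i) ≪ MMCD.lebesgue p q) :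
    ∀ᵐ ω ∂P, ∀ (w : ℝ → ℝ) (c₁ : ℝ), MMCD.IsWeightFunction w c₁ →
      -- the requirement on the weights, at all samples with fewer than `m` replaced observations
      (∀ Y : MMCD.Sample n p q,
        MMCD.IsCorruption (MMCD.breakdownCount n p q h - 1) (fun i => X i ω) Y →
          MMCD.HasEnoughPositiveWeights h w Y) →
      (MMCD.breakdownCount n p q h : ℝ≥0∞) / n ≤
          MMCD.locationBreakdownPoint (MMCD.reweightedMMCD h w) (fun i => X i ω) ∧
        (MMCD.breakdownCount n p q h : ℝ≥0∞) / n ≤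
          MMCD.covarianceBreakdownPoint (MMCD.reweightedMMCD h w) (fun i => X i ω) := by
  have hp0 : 0 < p := by omega
  have hq0 : 0 < q := by omega
  -- Genericity does not involve w or c₁, so a single null set serves all weight functions.
  filter_upwards [MMCD.ae_exists_isGeneric P hp0 hq0 X hindep
    (fun i => (hident i i).aemeasurable_fst) hcont] with ω hω w c₁ hw hW
  obtain ⟨ε, hε, hX⟩ := hω
  have hm : MMCD.breakdownCount n p q h = min (n - h + 1) (h - (MMCD.dimRatio p q + 1)) := rfl
  -- The two terms of the minimum defining m give exactly (m - 1) + h ≤ n and (m - 1) + (d + 2) ≤ h.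
  obtain ⟨C, R, hbound⟩ := MMCD.exists_reweightedMMCD_bound hp0 hq0 hε hX (by omega) (by omega) hw hW
  have hXX : MMCD.IsCorruption (MMCD.breakdownCount n p q h - 1) (fun i => X i ω)
      (fun i => X i ω) := by simp [MMCD.IsCorruption]
  constructor
  · exact MMCD.le_breakdownPoint ENNReal.ofReal_ne_top (fun Y hY => (hbound Y hY).1)
      fun Y hY θ hθ η hη => MMCD.locationDeviation_le ((hbound _ hXX).2 θ hθ).2
        ((hbound Y hY).2 η hη).2
  · exact MMCD.le_breakdownPoint ENNReal.ofReal_ne_top (fun Y hY => (hbound Y hY).1)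
      fun Y hY θ hθ η hη => MMCD.covarianceDeviation_le ((hbound _ hXX).2 θ hθ).1
        ((hbound Y hY).2 η hη).1
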